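/- Let $\rho,r\ge 0$ with $r+\frac{\rho}{2}\ge 1$ and $(\rho,r)\ne(0,1)$, let $p>1$, and let $g(u)=-|u|^{p-1}u$. Let $L$ and $B$ be the Fourier multiplier operators on $\mathbb R$ with smooth real symbols $l(\xi)$ and $b(\xi)$ (that is, $\widehat{Lf}=l\hat f$ and $\widehat{Bf}=b\hat f$, where $\hat f(\xi)=\int_{\mathbb R} f(x)e^{-i\xi x}\,dx$), such that for some constants $c_1,c_2,c_3,c_4>0$ and all $\xi\in\mathbb R$ $$c_1^2(1+\xi^2)^{\rho/2}\le l(\xi)\le c_2^2(1+\xi^2)^{\rho/2},\qquad c_3^2(1+\xi^2)^{-r/2}\le b(\xi)\le c_4^2(1+\xi^2)^{-r/2}.$$ Put $s_0=\frac r2+\frac\rho2$ and let $H^s=H^s(\mathbb R)$ denote the real-valued Sobolev space with norm $\|f\|_{H^s}^2=\int_{\mathbb R}(1+\xi^2)^s|\hat f(\xi)|^2\,d\xi$. For $(u,w)\in H^{s_0}\times H^{s_0-\rho/2}$ define $$\mathcal I(u)=\tfrac12\|B^{-1/2}L^{1/2}u\|_{L^2}^2,\qquad \mathcal Q(u)=\int_{\mathbb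 R}|u|^{p+1}\,dx,$$ $$\mathcal E(u,w)=\tfrac12\|B^{-1/2}w\|_{L^2}^2+\tfrac12\|B^{-1/2}L^{1/2}u\|_{L^2}^2-\tfrac1{p+1}\|u\|_{L^{p+1}}^{p+1},$$ $$d=\inf\{\mathcal E(u,w):\ (u,w)\in H^{s_0}\times H^{s_0-\rho/2},\ u\ne0,\ 2\mathcal I(u)-\mathcal Q(u)=0\},$$ $$\Sigma_+=\{(u,w)\in H^{s_0}\times H^{s_0-\rho/2}:\ \mathcal E(u,w)<d,\ 2\mathcal I(u)-\mathcal Q(u)\ge0\},$$ $$\Sigma_-=\{(u,w)\in H^{s_0}\times H^{s_0-\rho/2}:\ \mathcal E(u,w)<d,\ 2\mathcal I(u)-\mathcal Q(u)<0\}.$$ Let $0<T\le\infty$ and let $(u,w)\in C([0,T),H^{s_0})\times C([0,T),H^{s_0-\rho/2})$ be a solution on $[0,T)$ of the Cauchy problem $$u_t=w_x,\qquad w_t=Lu_x+B(g(u))_x,\qquad u(0)=u_0,\quad w(0)=w_0,$$ where the equations hold for every $0<t<T$ in the sense of tempered distributions in $x$. (In particular $T$ may be the maximal existence time $T_{\max}$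 of the solution.) If $(u_0,w_0)\in\Sigma_+$, then $(u(t),w(t))\in\Sigma_+$ for all $0<t<T$. If $(u_0,w_0)\in\Sigma_-$, then $(u(t),w(t))\in\Sigma_-$ for all $0<t<T$. -/

import Mathlib

open MeasureTheory Filter Topology
open scoped FourierTransform SchwartzMap ENNReal ContDiff

noncomputable section

namespace NonlocalWave

/-- Real square-integrable functions on the line (modulo a.e. equality). -/
abbrev RealL2 := Lp ℝ 2 (volume : Measure ℝ)

/-- Complex square-integrable functions on the line (modulo a.e. equality). -/
abbrev ComplexL2 := Lp ℂ 2 (volume : Measure ℝ)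

/-- A real `L²` function regarded as a complex one. -/
def toComplex (f : RealL2) : ComplexL2 := Complex.ofRealCLM.compLpL 2 volume f

/-- The `H^s` norm of an `L²` function, `s ≥ 0`, as an extended nonnegative number.
Mathlib's `L²` Fourier transform is `𝓕 f η = ∫ f x * exp (-2 π i x η) dx`, so that the frequency
`ξ` of the convention `f̂ ξ = ∫ f x * exp (-i x ξ) dx` is `ξ = 2 π η`. The value is
`(2π)^(-1/2) * (∫ (1 + ξ ^ 2) ^ s * |f̂ ξ| ^ 2 dξ)^(1/2)`. -/
def sobolevENorm (s : ℝ) (f : RealL2) : ℝ≥0∞ :=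
  (∫⁻ η : ℝ, ENNReal.ofReal ((1 + (2 * Real.pi * η) ^ 2) ^ s)
    * ‖(𝓕 (toComplex f) : ComplexL2) η‖ₑ ^ (2 : ℕ)) ^ (1 / 2 : ℝ)

/-- The Sobolev space `H^s(ℝ)` of real functions; for `s ≥ 0` it is a subset of `L²(ℝ)`. -/
def sobolev (s : ℝ) : Set RealL2 := {f | sobolevENorm s f < ⊤}

open scoped Classical in
/-- The Fourier multiplier operator `m(D)` with real symbol `m`, as an operator in `L²`: on its
natural domain `{f | m f̂ ∈ L²}` it is `f ↦ F⁻¹ (m f̂)`. (The value outside of the domain is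
set to `0`.) -/
def multiplier (m : ℝ → ℝ) (f : ComplexL2) : ComplexL2 :=
  if h : MemLp (fun η : ℝ => (m (2 * Real.pi * η) : ℂ) * (𝓕 f : ComplexL2) η) 2 volume then
    (𝓕⁻ (h.toLp _) : ComplexL2)
  else 0

/-- For `f ∈ L²` and a symbol `m` of polynomial growth, the tempered distribution
`m(D) f = F⁻¹ (m f̂)` evaluated at the Schwartz function `φ`. -/
def multiplierPairing (m : ℝ → ℝ) (f : ComplexL2) (φ : 𝓢(ℝ, ℂ)) : ℂ :=
  ∫ η : ℝ, (m (2 * Real.pi * η) : ℂ) * (𝓕 f : ComplexL2) η * (𝓕⁻ φ : 𝓢(ℝ, ℂ)) η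

/-- The distribution defined by an `L²` function, evaluated at the Schwartz function `φ`. -/
def pairing (f : RealL2) (φ : 𝓢(ℝ, ℂ)) : ℂ := ∫ x : ℝ, (f x : ℂ) * φ x

/-- The derivative of a Schwartz function. -/
def schwartzDeriv (φ : 𝓢(ℝ, ℂ)) : 𝓢(ℝ, ℂ) := SchwartzMap.derivCLM ℂ ℂ φ

open scoped Classical in
/-- `g(u) = -|u|^(p-1) u` as an `L²` function. (For `u ∈ H^s` with `s > 1/2` it always is
square-integrable, as `u` is then bounded; otherwise the value is set to `0`.) -/
def powerNonlinearity (p : ℝ) (u : RealL2) : RealL2 :=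
  if h : MemLp (fun x : ℝ => -(|u x| ^ (p - 1) * u x)) 2 volume then h.toLp _ else 0

/-- `B^(-1/2) w`. -/
def invSqrtB (b : ℝ → ℝ) (w : ComplexL2) : ComplexL2 :=
  multiplier (fun ξ => (b ξ) ^ (-(1 / 2) : ℝ)) w

/-- `L^(1/2) u`. -/
def sqrtL (l : ℝ → ℝ) (u : ComplexL2) : ComplexL2 :=
  multiplier (fun ξ => (l ξ) ^ (1 / 2 : ℝ)) u

/-- `I(u) = 1/2 ∫ (B^(-1/2) L^(1/2) u)^2 dx`. -/
def dispersiveEnergy (l b : ℝ → ℝ) (u : RealL2) : ℝ :=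
  1 / 2 * ‖invSqrtB b (sqrtL l (toComplex u))‖ ^ 2

/-- `Q(u) = ∫ |u|^(p+1) dx`. -/
def nonlinearEnergy (p : ℝ) (u : RealL2) : ℝ := ∫ x : ℝ, |u x| ^ (p + 1)

/-- The total energy
`E(u,w) = 1/2 ‖B^(-1/2) w‖² + 1/2 ‖B^(-1/2) L^(1/2) u‖² - 1/(p+1) ∫ |u|^(p+1) dx`. -/
def energy (l b : ℝ → ℝ) (p : ℝ) (u w : RealL2) : ℝ :=
  1 / 2 * ‖invSqrtB b (toComplex w)‖ ^ 2
    + 1 / 2 * ‖invSqrtB b (sqrtL l (toComplex u))‖ ^ 2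
    - 1 / (p + 1) * nonlinearEnergy p u

/-- The regularity exponent `s₀ = r/2 + ρ/2`. -/
def s₀ (ρ r : ℝ) : ℝ := r / 2 + ρ / 2

/-- The energy space `H^(s₀) × H^(s₀ - ρ/2)`. -/
def energySpace (ρ r : ℝ) : Set (RealL2 × RealL2) :=
  sobolev (s₀ ρ r) ×ˢ sobolev (s₀ ρ r - ρ / 2)

/-- The critical energy constant `d` (depth of the potential well): the infimum of the energy over
all `(u, w)` in the energy space with `u ≠ 0` and `2 I(u) - Q(u) = 0`. -/
def criticalEnergy (l b : ℝ → ℝ) (ρ r p : ℝ) : ℝ :=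
  sInf {e : ℝ | ∃ u w : RealL2, (u, w) ∈ energySpace ρ r ∧ u ≠ 0 ∧
    2 * dispersiveEnergy l b u - nonlinearEnergy p u = 0 ∧ e = energy l b p u w}

/-- The set `Σ₊`. -/
def sigmaPlus (l b : ℝ → ℝ) (ρ r p : ℝ) : Set (RealL2 × RealL2) :=
  {z | z ∈ energySpace ρ r ∧ energy l b p z.1 z.2 < criticalEnergy l b ρ r p ∧
    2 * dispersiveEnergy l b z.1 - nonlinearEnergy p z.1 ≥ 0}

/-- The set `Σ₋`. -/
def sigmaMinus (l b : ℝ → ℝ) (ρ r p : ℝ) : Set (RealL2 × RealL2) :=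
  {z | z ∈ energySpace ρ r ∧ energy l b p z.1 z.2 < criticalEnergy l b ρ r p ∧
    2 * dispersiveEnergy l b z.1 - nonlinearEnergy p z.1 < 0}

/-- The times `0 ≤ t < T`, where `T` may be infinite. -/
def timeInterval (T : EReal) : Set ℝ := {t : ℝ | 0 ≤ t ∧ (t : EReal) < T}

/-- `u ∈ C([0,T), H^s)`. -/
def ContinuousInSobolev (s : ℝ) (T : EReal) (u : ℝ → RealL2) : Prop :=
  (∀ t ∈ timeInterval T, u t ∈ sobolev s) ∧
  ∀ t ∈ timeInterval T,
    Tendsto (fun τ => sobolevENorm s (u τ - u t)) (𝓝[timeInterval T] t) (𝓝 0)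

/-- `(u, w)` is a solution on `[0,T)`, `0 < T ≤ ∞`, of the Cauchy problem
`u_t = w_x`, `w_t = L u_x + B (g(u))_x`, `u(0) = u₀`, `w(0) = w₀`, in the class
`C([0,T), H^(s₀)) × C([0,T), H^(s₀ - ρ/2))`. The two equations hold at every time `0 < t < T` in
the sense of tempered distributions in the space variable. -/
structure IsSolution (l b : ℝ → ℝ) (ρ r p : ℝ) (u₀ w₀ : RealL2) (T : EReal)
    (u w : ℝ → RealL2) : Prop where
  time_pos : 0 < T
  continuous_u : ContinuousInSobolev (s₀ ρ r) T u
  continuous_w : ContinuousInSobolev (s₀ ρ r - ρ / 2) T w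
  initial_u : u 0 = u₀
  initial_w : w 0 = w₀
  equation_u : ∀ φ : 𝓢(ℝ, ℂ), ∀ t : ℝ, 0 < t → (t : EReal) < T →
    HasDerivAt (fun τ => pairing (u τ) φ) (-pairing (w t) (schwartzDeriv φ)) t
  equation_w : ∀ φ : 𝓢(ℝ, ℂ), ∀ t : ℝ, 0 < t → (t : EReal) < T →
    HasDerivAt (fun τ => pairing (w τ) φ)
      (-multiplierPairing l (toComplex (u t)) (schwartzDeriv φ)
        - multiplierPairing b (toComplex (powerNonlinearity p (u t))) (schwartzDeriv φ)) t

end NonlocalWave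

end

/-! The proof rests on conservation of the energy (`energy_conservation`) and on the variational
meaning of d. While E < d, the continuous function P(t) = 2I(u(t)) - Q(u(t)) can vanish only where
u(t) = 0, since any other zero would compete in the infimum d. The Sobolev embedding H^s₀ ⊂ L^∞
gives Q(u) ≤ C‖u‖^(p-1) I(u) in the H^s₀ norm, so P ≥ 0 near u = 0. Hence {P ≥ 0} is open and closed
in [0,t], and the sign class of P is preserved (`nehari_nonneg_iff`).

Formally E' = ⟨B⁻¹w, Lu_x + B g(u)_x⟩ + ⟨B⁻¹Lu, w_x⟩ + ⟨g(u), w_x⟩ = 0, but for solutions of energy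
class the separate pairings need not make sense. The term ⟨g(u), w_x⟩ pairs w_x ∈ H^(r/2-1) with
g(u), so g(u) must lie in H^σ, σ = max(0, 1 - r/2). Since σ ≤ 1, σ ≤ s₀ and u is bounded, this holds
because g is Lipschitz on bounded sets: its differences are dominated by those of u, and H^σ norms
are integrals of differences (`mem_sobolev_of_norm_translate_sub_le`).

Continuity of t ↦ g(u(t)) in H^σ is not needed. Boundedness in H^σ and continuity in L² give weak
continuity, and convexity of |u|^(p+1) then yields (Q/(p+1))' = -⟨g(u), w_x⟩
(`hasDerivAt_nonlinearEnergy`). The quadratic part is cut off at |η| ≤ N, where everything is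
differentiable and the terms cancel frequency by frequency (`hasDerivAt_truncated`). What remains of
the derivative is the pairing of g(u) with the high frequencies of w_x. It tends to 0 uniformly on
compact time intervals because w is continuous in H^(r/2), so that w_x traces a compact set in
H^(-σ) (`energy_eq_of_mem_openTimes`).

All this takes place on the Fourier side: a function in H^s is represented by the L² function `lift
s f`, and operators of nonzero order become bounded multiplications `mulOp` between such
representatives. -/

noncomputable section

namespace NonlocalWave

/-! ### Multiplication by bounded symbols on L² -/

/-- Bounded measurable symbols. -/
structure BddSymbol (m : ℝ → ℂ) : Prop where
  measurable : Measurable m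
  bounded : ∃ C : ℝ, ∀ x, ‖m x‖ ≤ C

theorem BddSymbol.of_continuous_of_le {m : ℝ → ℂ} (hm : Continuous m) {C : ℝ}
    (hC : ∀ x, ‖m x‖ ≤ C) : BddSymbol m := ⟨hm.measurable, C, hC⟩

theorem BddSymbol.mul {m n : ℝ → ℂ} (hm : BddSymbol m) (hn : BddSymbol n) :
    BddSymbol (fun x => m x * n x) := by
  obtain ⟨C, hC⟩ := hm.bounded
  obtain ⟨D, hD⟩ := hn.bounded
  refine ⟨hm.measurable.mul hn.measurable, C * D, fun x => ?_⟩
  rw [norm_mul]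
  exact mul_le_mul (hC x) (hD x) (norm_nonneg _) ((norm_nonneg _).trans (hC x))

theorem BddSymbol.star {m : ℝ → ℂ} (hm : BddSymbol m) :
    BddSymbol (fun x => (starRingEnd ℂ) (m x)) := by
  obtain ⟨C, hC⟩ := hm.bounded
  exact ⟨Complex.continuous_conj.measurable.comp hm.measurable, C, fun x => by simpa using hC x⟩

theorem BddSymbol.memLp {m : ℝ → ℂ} (hm : BddSymbol m) (f : ComplexL2) :
    MemLp (fun x => m x * f x) 2 volume := by
  obtain ⟨C, hC⟩ := hm.bounded
  refine (Lp.memLp f).of_le_mul (c := C)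
    (hm.measurable.aestronglyMeasurable.mul (Lp.aestronglyMeasurable f)) (ae_of_all _ fun x => ?_)
  rw [norm_mul]
  exact mul_le_mul_of_nonneg_right (hC x) (norm_nonneg _)

open scoped Classical in
/-- Multiplication by a bounded measurable symbol as an operator in `L²` (and `0` for symbols that
are not of this kind). -/
def mulOp (m : ℝ → ℂ) : ComplexL2 →L[ℂ] ComplexL2 :=
  if h : BddSymbol m then
    LinearMap.mkContinuous
      { toFun := fun f => (h.memLp f).toLp _
        map_add' := fun f g => by
          rw [← MemLp.toLp_add]
          apply MemLp.toLp_congr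
          filter_upwards [Lp.coeFn_add f g] with x hx
          simp only [hx, Pi.add_apply, mul_add]
        map_smul' := fun c f => by
          rw [RingHom.id_apply, ← MemLp.toLp_const_smul]
          apply MemLp.toLp_congr
          filter_upwards [Lp.coeFn_smul c f] with x hx
          simp only [hx, Pi.smul_apply, smul_eq_mul]
          ring }
      h.bounded.choose
      (fun f => by
        refine Lp.norm_le_mul_norm_of_ae_le_mul ?_
        filter_upwards [(h.memLp f).coeFn_toLp] with x hx
        simp only [LinearMap.coe_mk, AddHom.coe_mk, hx, norm_mul]
        exact mul_le_mul_of_nonneg_right (h.bounded.choose_spec x) (norm_nonneg _))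
  else 0

theorem mulOp_ae {m : ℝ → ℂ} (hm : BddSymbol m) (f : ComplexL2) :
    mulOp m f =ᵐ[volume] fun x => m x * f x := by
  rw [mulOp, dif_pos hm]
  exact (hm.memLp f).coeFn_toLp

theorem mulOp_eq_of_ae {m : ℝ → ℂ} (hm : BddSymbol m) {f g : ComplexL2}
    (h : g =ᵐ[volume] fun x => m x * f x) : mulOp m f = g :=
  Lp.ext ((mulOp_ae hm f).trans h.symm)

theorem mulOp_mulOp {m n : ℝ → ℂ} (hm : BddSymbol m) (hn : BddSymbol n) (f : ComplexL2) :
    mulOp m (mulOp n f) = mulOp (fun x => m x * n x) f := by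
  apply Lp.ext
  filter_upwards [mulOp_ae hm (mulOp n f), mulOp_ae hn f, mulOp_ae (hm.mul hn) f] with x h1 h2 h3
  rw [h1, h2, h3, mul_assoc]

theorem norm_mulOp_le {m : ℝ → ℂ} (hm : BddSymbol m) {C : ℝ} (hC : ∀ x, ‖m x‖ ≤ C)
    (f : ComplexL2) : ‖mulOp m f‖ ≤ C * ‖f‖ := by
  refine Lp.norm_le_mul_norm_of_ae_le_mul ?_
  filter_upwards [mulOp_ae hm f] with x hx
  rw [hx, norm_mul]
  exact mul_le_mul_of_nonneg_right (hC x) (norm_nonneg _)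

theorem inner_mulOp_left {m : ℝ → ℂ} (hm : BddSymbol m) (f g : ComplexL2) :
    inner ℂ (mulOp m f) g = inner ℂ f (mulOp (fun x => (starRingEnd ℂ) (m x)) g) := by
  rw [L2.inner_def, L2.inner_def]
  apply integral_congr_ae
  filter_upwards [mulOp_ae hm f, mulOp_ae hm.star g] with x h1 h2
  rw [h1, h2]
  simp only [RCLike.inner_apply, map_mul]
  ring

/-! ### Sobolev weights -/

/-- The weight `(1 + ξ²)^(s/2)` at `ξ = 2πη`. -/
def wt (s η : ℝ) : ℝ := (1 + (2 * Real.pi * η) ^ 2) ^ (s / 2)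

theorem one_add_sq_pos (η : ℝ) : 0 < 1 + (2 * Real.pi * η) ^ 2 := by positivity

theorem wt_pos (s η : ℝ) : 0 < wt s η := Real.rpow_pos_of_pos (one_add_sq_pos η) _

theorem wt_add (s t η : ℝ) : wt (s + t) η = wt s η * wt t η := by
  rw [wt, add_div, Real.rpow_add (one_add_sq_pos η), wt, wt]

theorem wt_zero (η : ℝ) : wt 0 η = 1 := by simp [wt]

theorem wt_neg_mul (s η : ℝ) : wt (-s) η * wt s η = 1 := by
  rw [← wt_add, neg_add_cancel, wt_zero]

theorem wt_mul_neg (s η : ℝ) : wt s η * wt (-s) η = 1 := by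
  rw [← wt_add, add_neg_cancel, wt_zero]

theorem wt_le_wt {s t : ℝ} (h : s ≤ t) (η : ℝ) : wt s η ≤ wt t η :=
  Real.rpow_le_rpow_of_exponent_le (by nlinarith [sq_nonneg (2 * Real.pi * η)]) (by linarith)

theorem wt_le_one {s : ℝ} (h : s ≤ 0) (η : ℝ) : wt s η ≤ 1 := (wt_le_wt h η).trans_eq (wt_zero η)

theorem abs_le_wt_one (η : ℝ) : |2 * Real.pi * η| ≤ wt 1 η := by
  rw [wt, ← Real.sqrt_eq_rpow]
  apply Real.abs_le_sqrt
  linarith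

theorem wt_sq (s η : ℝ) : wt s η ^ 2 = (1 + (2 * Real.pi * η) ^ 2) ^ s := by
  rw [wt, ← Real.rpow_natCast, ← Real.rpow_mul (one_add_sq_pos η).le]
  congr 1
  push_cast
  ring

theorem continuous_wt (s : ℝ) : Continuous (wt s) := by
  unfold wt
  exact Continuous.rpow_const (by fun_prop) fun x => Or.inl (one_add_sq_pos x).ne'

theorem bddSymbol_wt {s : ℝ} (h : s ≤ 0) : BddSymbol (fun η => (wt s η : ℂ)) := by
  refine .of_continuous_of_le (Complex.continuous_ofReal.comp (continuous_wt s)) (C := 1) fun x => ?_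
  rw [Complex.norm_real, Real.norm_of_nonneg (wt_pos _ _).le]
  exact wt_le_one h x

/-- The symbol `iξ` of the derivative, at `ξ = 2πη`. -/
def derivSymbol (η : ℝ) : ℂ := 2 * Real.pi * η * Complex.I

theorem norm_derivSymbol (η : ℝ) : ‖derivSymbol η‖ = |2 * Real.pi * η| := by
  simp [derivSymbol, abs_mul]

theorem continuous_derivSymbol : Continuous derivSymbol := by
  unfold derivSymbol
  fun_prop

/-! ### Sobolev functions as weighted `L²` functions on the Fourier side -/

theorem toComplex_ae (f : RealL2) : toComplex f =ᵐ[volume] fun x => (f x : ℂ) :=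
  ContinuousLinearMap.coeFn_compLpL Complex.ofRealCLM f

theorem toComplex_sub (f g : RealL2) : toComplex (f - g) = toComplex f - toComplex g :=
  map_sub _ _ _

theorem norm_toComplex (f : RealL2) : ‖toComplex f‖ = ‖f‖ := by
  apply le_antisymm
  · have := Lp.norm_le_mul_norm_of_ae_le_mul (c := 1) (f := toComplex f) (g := f) (by
      filter_upwards [toComplex_ae f] with x hx
      rw [hx]; simp)
    simpa using this
  · have := Lp.norm_le_mul_norm_of_ae_le_mul (c := 1) (f := f) (g := toComplex f) (by
      filter_upwards [toComplex_ae f] with x hx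
      rw [hx]; simp)
    simpa using this

theorem inner_toComplex (f g : RealL2) :
    inner ℂ (toComplex f) (toComplex g) = ((inner ℝ f g : ℝ) : ℂ) := by
  rw [L2.inner_def, L2.inner_def, ← integral_complex_ofReal]
  apply integral_congr_ae
  filter_upwards [toComplex_ae f, toComplex_ae g] with x h1 h2
  rw [h1, h2]
  simp

open scoped Classical in
/-- `⟨ξ⟩^s f̂` as an `L²` function (`0` if `f ∉ H^s`). -/
def lift (s : ℝ) (f : RealL2) : ComplexL2 :=
  if h : MemLp (fun η : ℝ => (wt s η : ℂ) * (𝓕 (toComplex f) : ComplexL2) η) 2 volume then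
    h.toLp _
  else 0

theorem eLpNorm_wt_mul (s : ℝ) (f : RealL2) :
    eLpNorm (fun η : ℝ => (wt s η : ℂ) * (𝓕 (toComplex f) : ComplexL2) η) 2 volume
      = sobolevENorm s f := by
  rw [eLpNorm_eq_lintegral_rpow_enorm_toReal two_ne_zero ENNReal.ofNat_ne_top, sobolevENorm]
  simp only [ENNReal.toReal_ofNat]
  congr 1
  apply lintegral_congr
  intro η
  rw [ENNReal.rpow_two, enorm_mul, mul_pow]
  congr 1
  rw [← wt_sq, ENNReal.ofReal_pow (wt_pos _ _).le]
  congr 1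
  rw [← ofReal_norm, Complex.norm_real, Real.norm_of_nonneg (wt_pos _ _).le]

theorem mem_sobolev_iff (s : ℝ) (f : RealL2) : f ∈ sobolev s ↔
    MemLp (fun η : ℝ => (wt s η : ℂ) * (𝓕 (toComplex f) : ComplexL2) η) 2 volume := by
  rw [sobolev, Set.mem_ofPred_eq, ← eLpNorm_wt_mul]
  refine ⟨fun h => ⟨?_, h⟩, fun h => h.2⟩
  exact (Complex.continuous_ofReal.comp (continuous_wt s)).aestronglyMeasurable.mul
    (Lp.aestronglyMeasurable _)

theorem lift_ae {s : ℝ} {f : RealL2} (hf : f ∈ sobolev s) :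
    lift s f =ᵐ[volume] fun η => (wt s η : ℂ) * (𝓕 (toComplex f) : ComplexL2) η := by
  rw [lift, dif_pos ((mem_sobolev_iff s f).1 hf)]
  exact MemLp.coeFn_toLp _

theorem enorm_lift {s : ℝ} {f : RealL2} (hf : f ∈ sobolev s) : ‖lift s f‖ₑ = sobolevENorm s f := by
  rw [lift, dif_pos ((mem_sobolev_iff s f).1 hf), Lp.enorm_toLp, eLpNorm_wt_mul]

theorem fourier_toComplex_sub (f g : RealL2) :
    (𝓕 (toComplex (f - g)) : ComplexL2) = 𝓕 (toComplex f) - 𝓕 (toComplex g) := by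
  rw [toComplex_sub]
  exact map_sub (Lp.fourierTransformₗᵢ ℝ ℂ) _ _

theorem sub_mem_sobolev {s : ℝ} {f g : RealL2} (hf : f ∈ sobolev s) (hg : g ∈ sobolev s) :
    f - g ∈ sobolev s := by
  rw [mem_sobolev_iff] at *
  refine (memLp_congr_ae ?_).2 (hf.sub hg)
  rw [fourier_toComplex_sub]
  filter_upwards [Lp.coeFn_sub (𝓕 (toComplex f) : ComplexL2) (𝓕 (toComplex g))] with x hx
  rw [hx, Pi.sub_apply, Pi.sub_apply, mul_sub]

theorem lift_sub {s : ℝ} {f g : RealL2} (hf : f ∈ sobolev s) (hg : g ∈ sobolev s) :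
    lift s (f - g) = lift s f - lift s g := by
  apply Lp.ext
  have := lift_ae (sub_mem_sobolev hf hg)
  rw [fourier_toComplex_sub] at this
  filter_upwards [this, lift_ae hf, lift_ae hg, Lp.coeFn_sub (lift s f) (lift s g),
    Lp.coeFn_sub (𝓕 (toComplex f) : ComplexL2) (𝓕 (toComplex g))] with x h1 h2 h3 h4 h5
  rw [h1, h4, h5, Pi.sub_apply, Pi.sub_apply, h2, h3, mul_sub]

theorem sobolev_mono {s t : ℝ} (h : s ≤ t) {f : RealL2} (hf : f ∈ sobolev t) : f ∈ sobolev s := by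
  rw [mem_sobolev_iff] at *
  refine hf.of_le ?_ (ae_of_all _ fun x => ?_)
  · exact (Complex.continuous_ofReal.comp (continuous_wt s)).aestronglyMeasurable.mul
      (Lp.aestronglyMeasurable _)
  · rw [norm_mul, norm_mul, Complex.norm_real, Complex.norm_real,
      Real.norm_of_nonneg (wt_pos _ _).le, Real.norm_of_nonneg (wt_pos _ _).le]
    exact mul_le_mul_of_nonneg_right (wt_le_wt h x) (norm_nonneg _)

theorem mulOp_wt_lift {s t : ℝ} (h : t ≤ s) {f : RealL2} (hf : f ∈ sobolev s) :
    mulOp (fun η => (wt (t - s) η : ℂ)) (lift s f) = lift t f := by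
  apply mulOp_eq_of_ae (bddSymbol_wt (by linarith))
  filter_upwards [lift_ae (sobolev_mono h hf), lift_ae hf] with x h1 h2
  rw [h1, h2, ← mul_assoc, ← Complex.ofReal_mul, ← wt_add, sub_add_cancel]

theorem lift_zero_eq (f : RealL2) : f ∈ sobolev 0 ∧ lift 0 f = 𝓕 (toComplex f) := by
  have : f ∈ sobolev 0 := by
    rw [mem_sobolev_iff]
    simpa only [wt_zero, Complex.ofReal_one, one_mul] using Lp.memLp _
  refine ⟨this, Lp.ext ?_⟩
  filter_upwards [lift_ae this] with x h1
  rw [h1, wt_zero, Complex.ofReal_one, one_mul]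

theorem mulOp_wt_neg_lift {s : ℝ} (h : 0 ≤ s) {f : RealL2} (hf : f ∈ sobolev s) :
    mulOp (fun η => (wt (-s) η : ℂ)) (lift s f) = 𝓕 (toComplex f) := by
  rw [← (lift_zero_eq f).2, ← mulOp_wt_lift h hf, zero_sub]

theorem norm_le_norm_lift {s : ℝ} (h : 0 ≤ s) {f : RealL2} (hf : f ∈ sobolev s) :
    ‖f‖ ≤ ‖lift s f‖ := by
  rw [← norm_toComplex f, ← Lp.norm_fourier_eq, ← mulOp_wt_neg_lift h hf]
  refine (norm_mulOp_le (bddSymbol_wt (by linarith)) (C := 1) (fun x => ?_) _).trans_eq (one_mul _)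
  rw [Complex.norm_real, Real.norm_of_nonneg (wt_pos _ _).le]
  exact wt_le_one (by linarith) x

theorem zero_mem_sobolev (s : ℝ) : (0 : RealL2) ∈ sobolev s ∧ lift s 0 = 0 := by
  have h0 : (𝓕 (toComplex 0) : ComplexL2) = 0 := by
    have : toComplex 0 = 0 := map_zero _
    rw [this]
    exact map_zero (Lp.fourierTransformₗᵢ ℝ ℂ)
  have h : (0 : RealL2) ∈ sobolev s := by
    rw [mem_sobolev_iff, h0]
    refine (memLp_congr_ae ?_).2 (MemLp.zero' (ε := ℂ))
    filter_upwards [Lp.coeFn_zero ℂ 2 (volume : Measure ℝ)] with x hx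
    rw [hx]; simp
  refine ⟨h, ?_⟩
  rw [← sub_self (0 : RealL2), lift_sub h h, sub_self]

/-- On H^s the map `lift s` is additive and isometric, so continuity in H^s becomes norm continuity
of an L²-valued curve. -/
theorem ContinuousInSobolev.continuousOn_lift {s : ℝ} {T : EReal} {u : ℝ → RealL2}
    (hu : ContinuousInSobolev s T u) : ContinuousOn (fun τ => lift s (u τ)) (timeInterval T) := by
  intro t ht
  rw [ContinuousWithinAt, tendsto_iff_edist_tendsto_0]
  refine (hu.2 t ht).congr' ?_
  filter_upwards [self_mem_nhdsWithin] with τ hτ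
  rw [edist_eq_enorm_sub, ← lift_sub (hu.1 τ hτ) (hu.1 t ht),
    enorm_lift (sub_mem_sobolev (hu.1 τ hτ) (hu.1 t ht))]

/-! ### Differentiation lemmas in Hilbert spaces -/

/-- A curve which has a continuous derivative when tested against a separating family of functionals
is differentiable. -/
theorem hasDerivAt_of_separating {E ι : Type*} [NormedAddCommGroup E] [NormedSpace ℝ E]
    [CompleteSpace E] {ℓ : ι → E →L[ℝ] ℂ} (hsep : ∀ x, (∀ i, ℓ i x = 0) → x = 0) {s : Set ℝ}
    (hs : IsOpen s) (hs' : s.OrdConnected) {X Y : ℝ → E} (hY : ContinuousOn Y s)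
    (h : ∀ t ∈ s, ∀ i, HasDerivAt (fun τ => ℓ i (X τ)) (ℓ i (Y t)) t) {t : ℝ} (ht : t ∈ s) :
    HasDerivAt X (Y t) t := by
  have hZ : ∀ τ ∈ s, HasDerivAt (fun τ => ∫ σ in t..τ, Y σ) (Y τ) τ := by
    intro τ hτ
    refine intervalIntegral.integral_hasDerivAt_right ?_ ?_ (hY.continuousAt (hs.mem_nhds hτ))
    · exact (hY.mono (hs'.uIcc_subset ht hτ)).intervalIntegrable
    · exact hY.stronglyMeasurableAtFilter hs τ hτ
  -- Each functional of the difference of the two sides has zero derivative on an interval and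
  -- vanishes at t; the separating family then forces equality.
  have key : ∀ τ ∈ s, X τ = X t + ∫ σ in t..τ, Y σ := by
    intro τ hτ
    rw [← sub_eq_zero]
    apply hsep
    intro i
    have hD : ∀ τ ∈ s, HasDerivAt (fun τ => ℓ i (X τ) - ℓ i (X t) - ℓ i (∫ σ in t..τ, Y σ)) 0 τ := by
      intro τ hτ
      have h1 := ((ℓ i).hasFDerivAt.comp_hasDerivAt τ (hZ τ hτ))
      have h2 := ((h τ hτ i).sub_const (ℓ i (X t))).sub h1
      rw [sub_self] at h2
      exact h2
    have := hs.is_const_of_deriv_eq_zero hs'.isPreconnected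
      (fun τ hτ => (hD τ hτ).differentiableAt.differentiableWithinAt)
      (fun τ hτ => (hD τ hτ).deriv) hτ ht
    simp only [sub_self, intervalIntegral.integral_same, map_zero] at this
    simpa [sub_sub] using this
  refine ((hZ t ht).const_add (X t)).congr_of_eventuallyEq ?_
  filter_upwards [hs.mem_nhds ht] with τ hτ using key τ hτ

/-- A chain rule for a convex functional with gradient a: the two subgradient inequalities, at t and
at τ, squeeze the increment of Φ. Since X is differentiable, boundedness of a and its convergence
when tested against Z alone make both bounds equal up to o(τ - t). No differentiability of the
functional in the norm of H is required. -/
theorem hasDerivAt_of_inner_le_of_le_inner {H : Type*} [NormedAddCommGroup H]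
    [InnerProductSpace ℂ H] {X a : ℝ → H} {Z : H} {Φ : ℝ → ℝ} {t C : ℝ} (hX : HasDerivAt X Z t)
    (ha : ∀ᶠ τ in 𝓝 t, ‖a τ‖ ≤ C)
    (haw : Tendsto (fun τ => (inner ℂ (a τ) Z).re) (𝓝 t) (𝓝 (inner ℂ (a t) Z).re))
    (hl : ∀ᶠ τ in 𝓝 t, (inner ℂ (a t) (X τ - X t)).re ≤ Φ τ - Φ t)
    (hu : ∀ᶠ τ in 𝓝 t, Φ τ - Φ t ≤ (inner ℂ (a τ) (X τ - X t)).re) :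
    HasDerivAt Φ (inner ℂ (a t) Z).re t := by
  rw [hasDerivAt_iff_isLittleO] at hX ⊢
  have h1 : (fun τ => C * ‖X τ - X t - (τ - t) • Z‖) =o[𝓝 t] fun τ => τ - t :=
    (hX.norm_left).const_mul_left C
  have h2 : (fun τ => (τ - t) * ((inner ℂ (a τ) Z).re - (inner ℂ (a t) Z).re))
      =o[𝓝 t] fun τ => τ - t := by
    have : Tendsto (fun τ => (inner ℂ (a τ) Z).re - (inner ℂ (a t) Z).re) (𝓝 t) (𝓝 0) := by
      simpa using haw.sub_const (inner ℂ (a t) Z).re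
    simpa using (Asymptotics.isBigO_refl (fun τ => τ - t) (𝓝 t)).mul_isLittleO
      ((Asymptotics.isLittleO_one_iff ℝ).2 this)
  have h3 := h1.add h2.norm_left
  refine (Asymptotics.IsBigO.of_bound 1 ?_).trans_isLittleO h3
  filter_upwards [ha, hl, hu] with τ h4 h5 h6
  have hC : ‖a t‖ ≤ C := ha.self_of_nhds
  have e : ∀ b : H, (inner ℂ b (X τ - X t)).re = (inner ℂ b (X τ - X t - (τ - t) • Z)).re
      + (τ - t) * (inner ℂ b Z).re := by
    intro b
    rw [inner_sub_right b (X τ - X t), ← Complex.coe_smul, inner_smul_right, Complex.sub_re,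
      Complex.re_ofReal_mul]
    ring
  have bd : ∀ b : H, ‖b‖ ≤ C → |(inner ℂ b (X τ - X t - (τ - t) • Z)).re|
      ≤ C * ‖X τ - X t - (τ - t) • Z‖ := by
    intro b hb
    refine (Complex.abs_re_le_norm _).trans ((norm_inner_le_norm _ _).trans ?_)
    exact mul_le_mul_of_nonneg_right hb (norm_nonneg _)
  rw [e] at h5 h6
  have b1 := abs_le.1 (bd _ hC)
  have b2 := abs_le.1 (bd _ h4)
  have b3 := le_abs_self ((τ - t) * ((inner ℂ (a τ) Z).re - (inner ℂ (a t) Z).re))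
  have b4 := abs_nonneg ((τ - t) * ((inner ℂ (a τ) Z).re - (inner ℂ (a t) Z).re))
  rw [Real.norm_eq_abs, Real.norm_eq_abs, Real.norm_eq_abs, one_mul, smul_eq_mul]
  refine le_trans ?_ (le_abs_self _)
  rw [abs_le]
  constructor <;> nlinarith

/-- For a bounded family, replacing Z by z n costs an error uniform in τ, so the limits may be
interchanged. -/
theorem tendsto_inner_of_bounded {H α : Type*} [NormedAddCommGroup H] [InnerProductSpace ℂ H]
    {l : Filter α} {a : α → H} {a₀ Z : H} {z : ℕ → H} {C : ℝ} (ha : ∀ᶠ τ in l, ‖a τ‖ ≤ C)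
    (hz : Tendsto z atTop (𝓝 Z)) (h : ∀ n, Tendsto (fun τ => inner ℂ (a τ) (z n)) l
      (𝓝 (inner ℂ a₀ (z n)))) :
    Tendsto (fun τ => inner ℂ (a τ) Z) l (𝓝 (inner ℂ a₀ Z)) := by
  have hu : TendstoUniformlyOnFilter (fun n τ => inner ℂ (a τ) (z n)) (fun τ => inner ℂ (a τ) Z)
      atTop l := by
    rw [Metric.tendstoUniformlyOnFilter_iff]
    intro ε hε
    have h1 : ∀ᶠ n in atTop, ‖Z - z n‖ < ε / (|C| + 1) := by
      have := (tendsto_iff_norm_sub_tendsto_zero.1 hz).eventually_lt_const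
        (u := ε / (|C| + 1)) (by positivity)
      simpa only [norm_sub_rev] using this
    filter_upwards [h1.prod_mk ha] with p hp
    rw [dist_eq_norm, ← inner_sub_right]
    calc _ ≤ ‖a p.2‖ * ‖Z - z p.1‖ := norm_inner_le_norm _ _
      _ ≤ |C| * ‖Z - z p.1‖ :=
        mul_le_mul_of_nonneg_right (hp.2.trans (le_abs_self C)) (norm_nonneg _)
      _ < (|C| + 1) * (ε / (|C| + 1)) := by
        have := hp.1
        have h0 := abs_nonneg C
        nlinarith [norm_nonneg (Z - z p.1)]
      _ = ε := by field_simp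
  exact hu.tendsto_of_eventually_tendsto (Eventually.of_forall h)
    ((continuous_const.inner continuous_id).continuousAt.tendsto.comp hz)

/-- Contractions converging pointwise to 0 do so uniformly on compact sets: control them on a finite
ε/2-net. This disposes of the high-frequency remainder uniformly in time. -/
theorem eventually_forall_norm_le_of_isCompact {H : Type*} [NormedAddCommGroup H] [NormedSpace ℂ H]
    {T : ℕ → H →L[ℂ] H} (hT : ∀ n x, ‖T n x‖ ≤ ‖x‖) (h0 : ∀ x, Tendsto (fun n => T n x) atTop (𝓝 0))
    {K : Set H} (hK : IsCompact K) {ε : ℝ} (hε : 0 < ε) :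
    ∀ᶠ n in atTop, ∀ x ∈ K, ‖T n x‖ ≤ ε := by
  obtain ⟨F, -, hF, hcov⟩ := hK.finite_cover_balls (half_pos hε)
  have h1 : ∀ᶠ n in atTop, ∀ y ∈ F, ‖T n y‖ < ε / 2 := by
    rw [hF.eventually_all]
    intro y _
    exact (tendsto_zero_iff_norm_tendsto_zero.1 (h0 y)).eventually_lt_const (half_pos hε)
  filter_upwards [h1] with n hn x hx
  obtain ⟨y, hy, hxy⟩ := Set.mem_iUnion₂.1 (hcov hx)
  have h2 : T n x = T n (x - y) + T n y := by simp
  rw [h2]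
  have h3 := hT n (x - y)
  rw [Metric.mem_ball, dist_eq_norm] at hxy
  linarith [norm_add_le (T n (x - y)) (T n y), hn y hy]

/-! ### Frequency truncation -/

open scoped Classical in
/-- The indicator of `|η| ≤ N`. -/
def cut (N : ℕ) (η : ℝ) : ℂ := if |η| ≤ N then 1 else 0

theorem measurable_cut (N : ℕ) : Measurable (cut N) :=
  Measurable.ite (measurableSet_le measurable_norm measurable_const) measurable_const
    measurable_const

theorem norm_cut_le (N : ℕ) (η : ℝ) : ‖cut N η‖ ≤ 1 := by
  unfold cut; split_ifs <;> simp

theorem bddSymbol_cut (N : ℕ) : BddSymbol (cut N) := ⟨measurable_cut N, 1, norm_cut_le N⟩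

theorem bddSymbol_cut_mul (N : ℕ) {m : ℝ → ℂ} (hm : Continuous m) :
    BddSymbol (fun η => cut N η * m η) := by
  obtain ⟨C, hC⟩ := (isCompact_Icc (a := -(N : ℝ)) (b := N)).exists_bound_of_continuousOn
    hm.continuousOn
  refine ⟨(measurable_cut N).mul hm.measurable, |C|, fun x => ?_⟩
  unfold cut
  split_ifs with h
  · rw [one_mul]
    exact (hC x (abs_le.1 h)).trans (le_abs_self C)
  · simp

theorem bddSymbol_one_sub_cut (N : ℕ) : BddSymbol (fun η => 1 - cut N η) := by
  refine ⟨measurable_const.sub (measurable_cut N), 1, fun x => ?_⟩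
  unfold cut; split_ifs <;> simp

theorem norm_mulOp_one_sub_cut_le (N : ℕ) (f : ComplexL2) :
    ‖mulOp (fun η => 1 - cut N η) f‖ ≤ ‖f‖ := by
  refine (norm_mulOp_le (bddSymbol_one_sub_cut N) (C := 1) (fun x => ?_) f).trans_eq (one_mul _)
  unfold cut; split_ifs <;> simp

theorem mulOp_one_sub_cut (N : ℕ) (f : ComplexL2) :
    mulOp (fun η => 1 - cut N η) f = f - mulOp (cut N) f := by
  apply mulOp_eq_of_ae (bddSymbol_one_sub_cut N)
  filter_upwards [mulOp_ae (bddSymbol_cut N) f, Lp.coeFn_sub f (mulOp (cut N) f)] with x h1 h2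
  rw [h2, Pi.sub_apply, h1]
  ring

theorem tendsto_mulOp_one_sub_cut (f : ComplexL2) :
    Tendsto (fun N => mulOp (fun η => 1 - cut N η) f) atTop (𝓝 0) := by
  have hsq : ∀ g : ComplexL2, ‖g‖ ^ 2 = ∫ x, ‖g x‖ ^ 2 := by
    intro g
    have := L2.inner_def (𝕜 := ℂ) g g
    rw [inner_self_eq_norm_sq_to_K] at this
    simp only [inner_self_eq_norm_sq_to_K] at this
    have h2 : ((‖g‖ ^ 2 : ℝ) : ℂ) = ((∫ x, ‖g x‖ ^ 2 : ℝ) : ℂ) := by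
      rw [← integral_complex_ofReal]
      push_cast
      exact this
    exact_mod_cast h2
  have hint : Integrable (fun x => ‖f x‖ ^ 2) :=
    (memLp_two_iff_integrable_sq_norm (Lp.aestronglyMeasurable f)).1 (Lp.memLp f)
  rw [tendsto_zero_iff_norm_tendsto_zero]
  have h : Tendsto (fun N => ‖mulOp (fun η => 1 - cut N η) f‖ ^ 2) atTop (𝓝 0) := by
    have : Tendsto (fun N : ℕ => ∫ x, ‖(1 - cut N x) * f x‖ ^ 2) atTop (𝓝 (∫ x : ℝ, (0 : ℝ))) := by
      refine tendsto_integral_of_dominated_convergence (fun x => ‖f x‖ ^ 2) ?_ hint ?_ ?_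
      · intro N
        exact (((bddSymbol_one_sub_cut N).measurable.aestronglyMeasurable.mul
          (Lp.aestronglyMeasurable f)).norm.pow 2)
      · intro N
        refine ae_of_all _ fun x => ?_
        rw [Real.norm_of_nonneg (by positivity)]
        unfold cut; split_ifs <;> simp
      · refine ae_of_all _ fun x => ?_
        refine tendsto_const_nhds.congr' ?_
        filter_upwards [eventually_ge_atTop ⌈|x|⌉₊] with N hN
        rw [cut, if_pos (Nat.ceil_le.1 hN)]
        simp
    rw [integral_zero] at this
    refine this.congr fun N => ?_
    rw [hsq]
    apply integral_congr_ae
    filter_upwards [mulOp_ae (bddSymbol_one_sub_cut N) f] with x hx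
    rw [hx]
  have := h.sqrt
  simpa [Real.sqrt_sq (norm_nonneg _)] using this

theorem tendsto_mulOp_cut (f : ComplexL2) :
    Tendsto (fun N => mulOp (cut N) f) atTop (𝓝 f) := by
  have := (tendsto_mulOp_one_sub_cut f).const_sub f
  simpa [mulOp_one_sub_cut] using this

/-! ### The Fourier transform in `L²` -/

theorem integral_fourier_mul (f : ComplexL2) (ψ : 𝓢(ℝ, ℂ)) :
    ∫ x, (𝓕 f : ComplexL2) x * ψ x = ∫ x, f x * (𝓕 ψ : 𝓢(ℝ, ℂ)) x := by
  have h := congrArg (fun L => L ψ) (Lp.fourier_toTemperedDistribution_eq f)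
  simp only [TemperedDistribution.fourier_apply, Lp.toTemperedDistribution_apply, smul_eq_mul] at h
  simp only [mul_comm ((𝓕 f : ComplexL2) _), mul_comm (f _)]
  exact h.symm

theorem pairing_fourier (u : RealL2) (ψ : 𝓢(ℝ, ℂ)) :
    pairing u (𝓕 ψ) = ∫ η, (𝓕 (toComplex u) : ComplexL2) η * ψ η := by
  rw [integral_fourier_mul, pairing]
  apply integral_congr_ae
  filter_upwards [toComplex_ae u] with x hx
  rw [hx]

theorem hasTemperateGrowth_derivSymbol : Function.HasTemperateGrowth (fun η => -derivSymbol η) := by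
  unfold derivSymbol
  fun_prop

theorem schwartzDeriv_fourier (ψ : 𝓢(ℝ, ℂ)) :
    schwartzDeriv (𝓕 ψ) = 𝓕 (SchwartzMap.smulLeftCLM ℂ (fun η => -derivSymbol η) ψ) := by
  have hint : Integrable (fun x : ℝ => x • ψ x) := by
    have h : Function.HasTemperateGrowth (fun x : ℝ => x) := by fun_prop
    have := (SchwartzMap.smulLeftCLM ℂ (fun x : ℝ => x) ψ).integrable (μ := volume)
    rwa [SchwartzMap.smulLeftCLM_apply h] at this
  ext η
  rw [schwartzDeriv, SchwartzMap.derivCLM_apply, SchwartzMap.fourier_coe,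
    Real.deriv_fourier ψ.integrable hint, SchwartzMap.fourier_coe,
    SchwartzMap.smulLeftCLM_apply hasTemperateGrowth_derivSymbol]
  refine congrArg (fun g : ℝ → ℂ => 𝓕 g η) (funext fun x => ?_)
  simp only [derivSymbol]
  congr 1
  ring

theorem pairing_schwartzDeriv_fourier (u : RealL2) (ψ : 𝓢(ℝ, ℂ)) :
    -pairing u (schwartzDeriv (𝓕 ψ))
      = ∫ η, derivSymbol η * (𝓕 (toComplex u) : ComplexL2) η * ψ η := by
  rw [schwartzDeriv_fourier, pairing_fourier, ← integral_neg,
    SchwartzMap.smulLeftCLM_apply hasTemperateGrowth_derivSymbol]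
  congr 1
  ext η
  simp only [smul_eq_mul]
  ring

theorem multiplierPairing_schwartzDeriv_fourier (m : ℝ → ℝ) (f : ComplexL2) (ψ : 𝓢(ℝ, ℂ)) :
    -multiplierPairing m f (schwartzDeriv (𝓕 ψ))
      = ∫ η, derivSymbol η * (m (2 * Real.pi * η) : ℂ) * (𝓕 f : ComplexL2) η * ψ η := by
  rw [schwartzDeriv_fourier, multiplierPairing, ← integral_neg,
    FourierTransform.fourierInv_fourier_eq,
    SchwartzMap.smulLeftCLM_apply hasTemperateGrowth_derivSymbol]
  congr 1
  ext η
  simp only [smul_eq_mul]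
  ring

theorem ae_eq_of_integral_schwartz_eq {f g : ℝ → ℂ} (hf : LocallyIntegrable f)
    (hg : LocallyIntegrable g) (hfg : ∀ ψ : 𝓢(ℝ, ℂ), HasCompactSupport ψ →
      ∫ x, f x * ψ x = ∫ x, g x * ψ x) : f =ᵐ[volume] g := by
  have := ae_eq_zero_of_integral_contDiff_smul_eq_zero (hf.sub hg) fun φ hφ hc => by
    have hc' : HasCompactSupport (fun x => (φ x : ℂ)) := hc.comp_left (g := Complex.ofReal) rfl
    have hs : ContDiff ℝ ∞ (fun x => (φ x : ℂ)) := Complex.ofRealCLM.contDiff.comp hφ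
    have h := hfg (hc'.toSchwartzMap hs) hc'
    have hfi : Integrable (fun x => f x * (φ x : ℂ)) := by
      simpa [mul_comm, smul_eq_mul] using
        hf.integrable_smul_left_of_hasCompactSupport hs.continuous hc'
    have hgi : Integrable (fun x => g x * (φ x : ℂ)) := by
      simpa [mul_comm, smul_eq_mul] using
        hg.integrable_smul_left_of_hasCompactSupport hs.continuous hc'
    change ∫ x, f x * (φ x : ℂ) = ∫ x, g x * (φ x : ℂ) at h
    rw [← sub_eq_zero, ← integral_sub hfi hgi] at h
    rw [← h]
    congr 1
    ext x
    simp only [Pi.sub_apply, Complex.real_smul]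
    ring
  filter_upwards [this] with x hx
  exact sub_eq_zero.1 hx

theorem locallyIntegrable_coe (f : ComplexL2) : LocallyIntegrable f :=
  (Lp.memLp f).locallyIntegrable (by norm_num)

/-- A weighted `L²` evolution which has a continuous derivative in the sense of distributions is
differentiable. -/
theorem hasDerivAt_of_weak {M : ℝ → ℝ} (hM : Continuous M) (hM0 : ∀ η, 0 < M η)
    {X Y : ℝ → ComplexL2} {U V : ℝ → ℝ → ℂ} {s : Set ℝ} (hs : IsOpen s) (hs' : s.OrdConnected)
    (hY : ContinuousOn Y s) (hX : ∀ τ ∈ s, X τ =ᵐ[volume] fun η => (M η : ℂ) * U τ η)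
    (hYV : ∀ τ ∈ s, Y τ =ᵐ[volume] fun η => (M η : ℂ) * V τ η)
    (h : ∀ ψ : 𝓢(ℝ, ℂ), HasCompactSupport ψ → ∀ t ∈ s,
      HasDerivAt (fun τ => ∫ η, U τ η * ψ η) (∫ η, V t η * ψ η) t) {t : ℝ} (ht : t ∈ s) :
    HasDerivAt X (Y t) t := by
  have hMC : ∀ η, (M η : ℂ) ≠ 0 := fun η => Complex.ofReal_ne_zero.2 (hM0 η).ne'
  -- Testing U against ψ is an L² inner product of X = M U with the conjugate of M⁻¹ψ; compact
  -- support of ψ makes the latter square integrable however fast M⁻¹ grows.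
  have hmem : ∀ ψ : {ψ : 𝓢(ℝ, ℂ) // HasCompactSupport ψ},
      MemLp (fun η => (starRingEnd ℂ) ((M η : ℂ)⁻¹ * ψ.1 η)) 2 (volume : Measure ℝ) := by
    intro ψ
    refine Continuous.memLp_of_hasCompactSupport ?_ ?_
    · refine Complex.continuous_conj.comp (Continuous.mul ?_ ψ.1.continuous)
      exact (Complex.continuous_ofReal.comp hM).inv₀ hMC
    · exact (ψ.2.mul_left (f := fun η => (M η : ℂ)⁻¹)).comp_left (map_zero _)
  have hinner : ∀ (ψ : {ψ : 𝓢(ℝ, ℂ) // HasCompactSupport ψ}) (x : ComplexL2),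
      inner ℂ ((hmem ψ).toLp _) x = ∫ η, ((M η : ℂ)⁻¹ * x η) * ψ.1 η := by
    intro ψ x
    rw [L2.inner_def]
    apply integral_congr_ae
    filter_upwards [(hmem ψ).coeFn_toLp] with η hη
    rw [hη]
    simp only [RCLike.inner_apply, Complex.conj_conj]
    ring
  refine hasDerivAt_of_separating (ι := {ψ : 𝓢(ℝ, ℂ) // HasCompactSupport ψ})
    (ℓ := fun ψ => (innerSL ℂ ((hmem ψ).toLp _)).restrictScalars ℝ) ?_ hs hs' hY ?_ ht
  · intro x hx
    have hli : LocallyIntegrable (fun η => (M η : ℂ)⁻¹ * x η) :=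
      (locallyIntegrable_coe x).continuous_mul ((Complex.continuous_ofReal.comp hM).inv₀ hMC)
    have := ae_eq_of_integral_schwartz_eq hli (locallyIntegrable_zero (μ := volume))
      fun ψ hψ => by
        have := (hinner ⟨ψ, hψ⟩ x).symm.trans (hx ⟨ψ, hψ⟩)
        simpa using this
    apply Lp.ext
    filter_upwards [this, Lp.coeFn_zero ℂ 2 (volume : Measure ℝ)] with η h1 h2
    rw [h2]
    simpa [hMC η] using h1
  · intro t ht ψ
    simp only [ContinuousLinearMap.coe_restrictScalars', innerSL_apply_apply, hinner]
    have e2 : ∫ η, ((M η : ℂ)⁻¹ * Y t η) * ψ.1 η = ∫ η, V t η * ψ.1 η := by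
      apply integral_congr_ae
      filter_upwards [hYV t ht] with η hη
      rw [hη, inv_mul_cancel_left₀ (hMC η)]
    rw [e2]
    refine (h ψ.1 ψ.2 t ht).congr_of_eventuallyEq ?_
    filter_upwards [hs.mem_nhds ht] with τ hτ
    apply integral_congr_ae
    filter_upwards [hX τ hτ] with η hη
    rw [hη, inv_mul_cancel_left₀ (hMC η)]

/-- Fourier inversion for `L²` functions with integrable Fourier transform. -/
theorem ae_eq_fourierInv_of_integrable {f : ComplexL2} (hf : Integrable (𝓕 f : ComplexL2)) :
    f =ᵐ[volume] 𝓕⁻ ((𝓕 f : ComplexL2) : ℝ → ℂ) := by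
  have hcont : Continuous (𝓕⁻ ((𝓕 f : ComplexL2) : ℝ → ℂ)) := by
    rw [Real.fourierInv_eq_fourier_comp_neg]
    exact VectorFourier.fourierIntegral_continuous Real.continuous_fourierChar
      (L := innerₗ ℝ) continuous_inner hf.comp_neg
  refine ae_eq_of_integral_schwartz_eq (locallyIntegrable_coe f) hcont.locallyIntegrable
    fun ψ _ => ?_
  have h1 := integral_fourier_mul f (𝓕⁻ ψ)
  rw [FourierTransform.fourier_fourierInv_eq] at h1
  rw [← h1]
  -- Fubini moves the transform from the integrable function 𝓕 f onto the reflected test function.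
  have h2 := VectorFourier.integral_fourierIntegral_smul_eq_flip (L := innerₗ ℝ)
    Real.continuous_fourierChar continuous_inner hf (ψ.integrable (μ := volume)).comp_neg
  rw [← integral_neg_eq_self] at h2
  simp only [neg_neg, smul_eq_mul] at h2
  calc ∫ x, (𝓕 f : ComplexL2) x * (𝓕⁻ ψ : 𝓢(ℝ, ℂ)) x
      = ∫ x, (𝓕 f : ComplexL2) x * VectorFourier.fourierIntegral Real.fourierChar volume
          (innerₗ ℝ).flip (fun x => ψ (-x)) x := by
        congr 1
        ext x
        congr 1
        rw [SchwartzMap.fourierInv_coe, Real.fourierInv_eq_fourier_comp_neg, flip_innerₗ]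
        rfl
    _ = _ := h2.symm
    _ = _ := by
        congr 1
        ext x
        congr 1
        rw [Real.fourierInv_eq_fourier_neg]
        rfl

theorem norm_fourierInv_le (g : ℝ → ℂ) (x : ℝ) : ‖𝓕⁻ g x‖ ≤ ∫ η, ‖g η‖ := by
  rw [Real.fourierInv_eq_fourier_neg]
  exact VectorFourier.norm_fourierIntegral_le_integral_norm _ _ _ _ _

theorem memLp_wt_neg {s : ℝ} (hs : 1 / 2 < s) : MemLp (wt (-s)) 2 volume := by
  rw [memLp_two_iff_integrable_sq (continuous_wt _).aestronglyMeasurable]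
  have h1 : Integrable (fun x : ℝ => (1 + ‖x‖ ^ 2) ^ (-(2 * s) / 2)) :=
    integrable_rpow_neg_one_add_norm_sq (by simp; linarith)
  have h2 := h1.comp_mul_left' (R := 2 * Real.pi) (by positivity)
  refine h2.congr (ae_of_all _ fun x => ?_)
  simp only [wt_sq, Real.norm_eq_abs, sq_abs]
  congr 1
  ring

/-- The Sobolev embedding `H^s ⊂ L^∞`, `s > 1/2`. -/
theorem exists_abs_le_norm_lift {s : ℝ} (hs : 1 / 2 < s) : ∃ C : ℝ, 0 < C ∧
    ∀ f : RealL2, f ∈ sobolev s → ∀ᵐ x, |f x| ≤ C * ‖lift s f‖ := by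
  refine ⟨‖(memLp_wt_neg hs).toLp _‖ + 1, by positivity, fun f hf => ?_⟩
  have hL : MemLp (fun η => ‖lift s f η‖) 2 volume := (Lp.memLp _).norm
  have hF : (fun η => ‖(𝓕 (toComplex f) : ComplexL2) η‖) =ᵐ[volume]
      fun η => wt (-s) η * ‖lift s f η‖ := by
    rw [← mulOp_wt_neg_lift (by linarith) hf]
    filter_upwards [mulOp_ae (bddSymbol_wt (s := -s) (by linarith)) (lift s f)] with η hη
    rw [hη, norm_mul, Complex.norm_real, Real.norm_of_nonneg (wt_pos _ _).le]
  have hi : Integrable (𝓕 (toComplex f) : ComplexL2) := by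
    rw [← integrable_norm_iff (Lp.aestronglyMeasurable _)]
    exact ((memLp_wt_neg hs).integrable_mul hL).congr hF.symm
  -- Cauchy–Schwarz for the product of ⟨ξ⟩^(-s), which is in L² because 2s > 1, with the lift.
  have hb : ∫ η, ‖(𝓕 (toComplex f) : ComplexL2) η‖
      ≤ ‖(memLp_wt_neg hs).toLp _‖ * ‖lift s f‖ := by
    have hn : ‖hL.toLp _‖ = ‖lift s f‖ := by
      rw [Lp.norm_toLp, Lp.norm_def, eLpNorm_norm]
    rw [← hn]
    refine le_trans (le_of_eq ?_) ((le_abs_self _).trans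
      (abs_real_inner_le_norm ((memLp_wt_neg hs).toLp _) (hL.toLp _)))
    rw [L2.inner_def]
    apply integral_congr_ae
    filter_upwards [hF, (memLp_wt_neg hs).coeFn_toLp, hL.coeFn_toLp] with η h1 h2 h3
    rw [h1, h2, h3]
    simp [mul_comm]
  filter_upwards [ae_eq_fourierInv_of_integrable hi, toComplex_ae f] with x h1 h2
  have h3 := norm_fourierInv_le ((𝓕 (toComplex f) : ComplexL2) : ℝ → ℂ) x
  rw [← h1, h2, Complex.norm_real, Real.norm_eq_abs] at h3
  nlinarith [norm_nonneg (lift s f)]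

/-! ### Translations -/

/-- Translation by `h`. -/
def translate {E : Type*} [NormedAddCommGroup E] (h : ℝ) (f : Lp E 2 (volume : Measure ℝ)) :
    Lp E 2 (volume : Measure ℝ) :=
  Lp.compMeasurePreserving (fun x : ℝ => x + h) (measurePreserving_add_right volume h) f

theorem translate_ae {E : Type*} [NormedAddCommGroup E] (h : ℝ)
    (f : Lp E 2 (volume : Measure ℝ)) : translate h f =ᵐ[volume] fun x => f (x + h) :=
  Lp.coeFn_compMeasurePreserving f _

theorem translate_toComplex (h : ℝ) (f : RealL2) :
    translate h (toComplex f) = toComplex (translate h f) := by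
  apply Lp.ext
  filter_upwards [translate_ae h (toComplex f), toComplex_ae (translate h f), translate_ae h f,
    (measurePreserving_add_right volume h).quasiMeasurePreserving.ae (toComplex_ae f)]
    with x h1 h2 h3 h4
  rw [h1, h2, h3, h4]

/-- The symbol of the translation by `h`. -/
def translateSymbol (h η : ℝ) : ℂ := Complex.exp (2 * Real.pi * h * η * Complex.I)

theorem norm_translateSymbol (h η : ℝ) : ‖translateSymbol h η‖ = 1 := by
  have : (2 * Real.pi * h * η * Complex.I : ℂ) = ((2 * Real.pi * h * η : ℝ) : ℂ) * Complex.I := by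
    push_cast; ring
  rw [translateSymbol, this, Complex.norm_exp_ofReal_mul_I]

theorem contDiff_translateSymbol (h : ℝ) : ContDiff ℝ ∞ (translateSymbol h) := by
  unfold translateSymbol
  refine Complex.contDiff_exp.comp ?_
  exact ((contDiff_const.mul Complex.ofRealCLM.contDiff).mul contDiff_const)

theorem bddSymbol_translateSymbol (h : ℝ) : BddSymbol (translateSymbol h) :=
  .of_continuous_of_le (contDiff_translateSymbol h).continuous
    fun x => (norm_translateSymbol h x).le

/-- By duality: the translation passes to 𝓕ψ, and a translate of 𝓕ψ is the transform of a modulated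
ψ. -/
theorem fourier_translate (h : ℝ) (f : ComplexL2) :
    𝓕 (translate h f) = mulOp (translateSymbol h) (𝓕 f : ComplexL2) := by
  apply Lp.ext
  refine ae_eq_of_integral_schwartz_eq (locallyIntegrable_coe _) (locallyIntegrable_coe _)
    fun ψ hψ => ?_
  have hc : HasCompactSupport (fun η => translateSymbol h η * ψ η) := hψ.mul_left
  have hs : ContDiff ℝ ∞ (fun η => translateSymbol h η * ψ η) :=
    (contDiff_translateSymbol h).mul ψ.smooth'
  set χ : 𝓢(ℝ, ℂ) := hc.toSchwartzMap hs with hχ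
  have e1 : ∀ x, (𝓕 ψ : 𝓢(ℝ, ℂ)) (x - h) = (𝓕 χ : 𝓢(ℝ, ℂ)) x := by
    intro x
    rw [SchwartzMap.fourier_coe, SchwartzMap.fourier_coe, Real.fourier_real_eq_integral_exp_smul,
      Real.fourier_real_eq_integral_exp_smul]
    congr 1
    ext η
    change _ = Complex.exp _ • (translateSymbol h η * ψ η)
    rw [smul_eq_mul, smul_eq_mul, ← mul_assoc, translateSymbol, ← Complex.exp_add]
    congr 2
    push_cast
    ring
  calc ∫ x, (𝓕 (translate h f) : ComplexL2) x * ψ x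
      = ∫ x, translate h f x * (𝓕 ψ : 𝓢(ℝ, ℂ)) x := integral_fourier_mul _ _
    _ = ∫ x, f (x + h) * (𝓕 ψ : 𝓢(ℝ, ℂ)) (x + h - h) := by
        apply integral_congr_ae
        filter_upwards [translate_ae h f] with x hx
        rw [hx, add_sub_cancel_right]
    _ = ∫ x, f x * (𝓕 ψ : 𝓢(ℝ, ℂ)) (x - h) :=
        integral_add_right_eq_self (fun x => f x * (𝓕 ψ : 𝓢(ℝ, ℂ)) (x - h)) h
    _ = ∫ x, f x * (𝓕 χ : 𝓢(ℝ, ℂ)) x := by simp only [e1]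
    _ = ∫ x, (𝓕 f : ComplexL2) x * χ x := (integral_fourier_mul _ _).symm
    _ = _ := by
        apply integral_congr_ae
        filter_upwards [mulOp_ae (bddSymbol_translateSymbol h) (𝓕 f : ComplexL2)] with x hx
        rw [hx]
        change _ * (translateSymbol h x * ψ x) = _
        ring

theorem enorm_sq_eq_lintegral (f : ComplexL2) : ‖f‖ₑ ^ 2 = ∫⁻ x, ‖f x‖ₑ ^ 2 := by
  rw [Lp.enorm_def, eLpNorm_eq_lintegral_rpow_enorm_toReal two_ne_zero ENNReal.ofNat_ne_top]
  simp only [ENNReal.toReal_ofNat, ENNReal.rpow_two]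
  rw [← ENNReal.rpow_two, ← ENNReal.rpow_mul]
  norm_num

theorem enorm_translate_sub_sq (h : ℝ) (f : RealL2) :
    ‖translate h f - f‖ₑ ^ 2
      = ∫⁻ η, ‖translateSymbol h η - 1‖ₑ ^ 2 * ‖(𝓕 (toComplex f) : ComplexL2) η‖ₑ ^ 2 := by
  have h1 : ‖translate h f - f‖ₑ = ‖(𝓕 (toComplex (translate h f - f)) : ComplexL2)‖ₑ := by
    rw [← ofReal_norm, ← ofReal_norm, Lp.norm_fourier_eq, norm_toComplex]
  rw [h1, enorm_sq_eq_lintegral, fourier_toComplex_sub, ← translate_toComplex, fourier_translate]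
  apply lintegral_congr_ae
  filter_upwards [mulOp_ae (bddSymbol_translateSymbol h) (𝓕 (toComplex f) : ComplexL2),
    Lp.coeFn_sub (mulOp (translateSymbol h) (𝓕 (toComplex f) : ComplexL2)) (𝓕 (toComplex f))]
    with x h2 h3
  rw [h3, Pi.sub_apply, h2, ← mul_pow, ← enorm_mul, sub_mul, one_mul]

/-! ### Fractional Sobolev norms through differences -/

theorem translateSymbol_eq (h η : ℝ) : translateSymbol h η = translateSymbol (h * η) 1 := by
  simp only [translateSymbol]
  push_cast
  ring_nf

theorem enorm_translateSymbol_sub_one_abs (x : ℝ) :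
    ‖translateSymbol |x| 1 - 1‖ₑ = ‖translateSymbol x 1 - 1‖ₑ := by
  rcases abs_choice x with h | h
  · rw [h]
  · rw [h]
    have : translateSymbol (-x) 1 - 1 = (starRingEnd ℂ) (translateSymbol x 1 - 1) := by
      rw [translateSymbol, translateSymbol, map_sub, map_one, ← Complex.exp_conj]
      simp [Complex.conj_ofNat]
    rw [this, RCLike.enorm_conj]

theorem norm_translateSymbol_sub_one_le (h η : ℝ) :
    ‖translateSymbol h η - 1‖ ≤ |h| * |2 * Real.pi * η| := by
  have := Real.norm_exp_I_mul_ofReal_sub_one_le (x := 2 * Real.pi * h * η)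
  rw [← abs_mul]
  convert this using 2
  · rw [translateSymbol]
    push_cast
    ring_nf
  · rw [Real.norm_eq_abs]
    ring_nf

theorem continuous_translateSymbol : Continuous fun p : ℝ × ℝ => translateSymbol p.1 p.2 := by
  unfold translateSymbol
  fun_prop

/-- The density `h^(-1-2σ)` on the half line. -/
def gagliardoWeight (σ h : ℝ) : ℝ≥0∞ :=
  (Set.Ioi (0 : ℝ)).indicator (fun h => ENNReal.ofReal (h ^ (-1 - 2 * σ))) h

theorem measurable_gagliardoWeight (σ : ℝ) : Measurable (gagliardoWeight σ) :=
  Measurable.indicator (by fun_prop) measurableSet_Ioi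

theorem gagliardoWeight_mul {σ a : ℝ} (ha : 0 < a) (h : ℝ) :
    gagliardoWeight σ h = ENNReal.ofReal (a ^ (1 + 2 * σ)) * gagliardoWeight σ (a * h) := by
  by_cases hh : 0 < h
  · have hah : 0 < a * h := mul_pos ha hh
    rw [gagliardoWeight, gagliardoWeight, Set.indicator_of_mem (Set.mem_Ioi.2 hh),
      Set.indicator_of_mem (Set.mem_Ioi.2 hah), ← ENNReal.ofReal_mul (by positivity),
      Real.mul_rpow ha.le hh.le, ← mul_assoc, ← Real.rpow_add ha]
    norm_num
  · have hah : ¬ 0 < a * h := fun H => hh ((mul_pos_iff_of_pos_left ha).1 H)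
    rw [gagliardoWeight, gagliardoWeight, Set.indicator_of_notMem (by simpa using hh),
      Set.indicator_of_notMem (by simpa using hah), mul_zero]

/-- `∫₀^∞ |e^(2πih) - 1|² h^(-1-2σ) dh`. -/
def gagliardoConst (σ : ℝ) : ℝ≥0∞ :=
  ∫⁻ h, ‖translateSymbol h 1 - 1‖ₑ ^ 2 * gagliardoWeight σ h

theorem measurable_gagliardo (σ : ℝ) :
    Measurable fun h => ‖translateSymbol h 1 - 1‖ₑ ^ 2 * gagliardoWeight σ h := by
  refine Measurable.mul ?_ (measurable_gagliardoWeight σ)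
  have : Continuous fun h : ℝ => translateSymbol h 1 :=
    continuous_translateSymbol.comp (by fun_prop : Continuous fun h : ℝ => (h, (1 : ℝ)))
  exact ((this.sub continuous_const).enorm.measurable).pow_const 2

/-- The integrand depends on h through |η|h up to the homogeneity of the weight, so rescaling h
extracts the power of |η|. -/
theorem lintegral_gagliardo {σ : ℝ} (hσ : 0 < σ) (η : ℝ) :
    ∫⁻ h, ‖translateSymbol h η - 1‖ₑ ^ 2 * gagliardoWeight σ h
      = ENNReal.ofReal (|η| ^ (2 * σ)) * gagliardoConst σ := by
  rcases eq_or_ne η 0 with rfl | hη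
  · have : ∀ h, translateSymbol h 0 - 1 = 0 := fun h => by simp [translateSymbol]
    simp [this, Real.zero_rpow (by positivity : (2 * σ) ≠ 0)]
  have ha : 0 < |η| := abs_pos.2 hη
  set G : ℝ → ℝ≥0∞ := fun h => ‖translateSymbol h 1 - 1‖ₑ ^ 2 * gagliardoWeight σ h with hG
  have e1 : ∀ h, ‖translateSymbol h η - 1‖ₑ ^ 2 * gagliardoWeight σ h
      = ENNReal.ofReal (|η| ^ (1 + 2 * σ)) * G (|η| * h) := by
    intro h
    rw [gagliardoWeight_mul ha h, translateSymbol_eq, ← enorm_translateSymbol_sub_one_abs, abs_mul]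
    by_cases hh : 0 < h
    · rw [abs_of_pos hh, hG]
      simp only
      rw [mul_comm h]
      ring
    · have hah : ¬ 0 < |η| * h := fun H => hh ((mul_pos_iff_of_pos_left ha).1 H)
      have : gagliardoWeight σ (|η| * h) = 0 := Set.indicator_of_notMem (by simpa using hah) _
      simp [hG, this]
  simp only [e1]
  rw [lintegral_const_mul' _ _ ENNReal.ofReal_ne_top]
  have e2 : ∫⁻ h, G (|η| * h) = ENNReal.ofReal |(|η|)⁻¹| * ∫⁻ h, G h := by
    rw [← lintegral_map (measurable_gagliardo σ) (measurable_const_mul |η|),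
      Real.map_volume_mul_left ha.ne', lintegral_smul_measure, smul_eq_mul]
  rw [e2, ← mul_assoc, ← ENNReal.ofReal_mul (by positivity), abs_of_pos (inv_pos.2 ha),
    add_comm, Real.rpow_add ha, Real.rpow_one, mul_assoc, mul_inv_cancel₀ ha.ne', mul_one]
  rfl

theorem gagliardoConst_ne_zero (σ : ℝ) : gagliardoConst σ ≠ 0 := by
  intro h
  rw [gagliardoConst, lintegral_eq_zero_iff (measurable_gagliardo σ)] at h
  have hnull : volume (Set.Ioo (0 : ℝ) 1) = 0 := by
    refine measure_mono_null (fun x hx => ?_) (ae_iff.1 h)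
    simp only [Set.mem_ofPred_eq, Pi.zero_apply, mul_eq_zero, not_or]
    constructor
    · simp only [ne_eq, OfNat.ofNat_ne_zero, not_false_eq_true, pow_eq_zero_iff, enorm_eq_zero,
        sub_eq_zero]
      rw [translateSymbol, Complex.exp_eq_one_iff]
      rintro ⟨n, hn⟩
      have hpi : (2 * Real.pi * Complex.I : ℂ) ≠ 0 := Complex.two_pi_I_ne_zero
      have h1 : (x : ℂ) = n := by
        apply mul_right_cancel₀ hpi
        rw [← hn]
        push_cast
        ring
      have h2 : x = (n : ℝ) := by exact_mod_cast h1
      have h3 := hx.1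
      have h4 := hx.2
      rw [h2] at h3 h4
      have h5 : 0 < n := by exact_mod_cast h3
      have h6 : n < 1 := by exact_mod_cast h4
      omega
    · rw [gagliardoWeight, Set.indicator_of_mem (Set.mem_Ioi.2 hx.1)]
      simpa using Real.rpow_pos_of_pos hx.1 _
  simp at hnull

/-- The integrand is O(h^(1-2σ)) near 0, integrable for σ < 1, and O(h^(-1-2σ)) at infinity,
integrable for σ > 0. -/
theorem gagliardoConst_ne_top {σ : ℝ} (hσ : 0 < σ) (hσ' : σ < 1) : gagliardoConst σ ≠ ⊤ := by
  have h1 : gagliardoConst σ = ∫⁻ h in Set.Ioi (0 : ℝ),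
      ‖translateSymbol h 1 - 1‖ₑ ^ 2 * ENNReal.ofReal (h ^ (-1 - 2 * σ)) := by
    rw [gagliardoConst, ← lintegral_indicator measurableSet_Ioi]
    congr 1
    ext h
    rw [gagliardoWeight]
    by_cases hh : h ∈ Set.Ioi (0 : ℝ)
    · rw [Set.indicator_of_mem hh, Set.indicator_of_mem hh]
    · rw [Set.indicator_of_notMem hh, Set.indicator_of_notMem hh, mul_zero]
  rw [h1, ← Set.Ioc_union_Ioi_eq_Ioi (zero_le_one (α := ℝ))]
  refine ((lintegral_union_le _ _ _).trans_lt ?_).ne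
  refine ENNReal.add_lt_top.2 ⟨?_, ?_⟩
  · have hi : IntegrableOn (fun h : ℝ => (2 * Real.pi) ^ 2 * h ^ (1 - 2 * σ)) (Set.Ioc 0 1) :=
      ((intervalIntegrable_iff_integrableOn_Ioc_of_le zero_le_one).1
        (intervalIntegral.intervalIntegrable_rpow' (by linarith))).const_mul _
    refine (setLIntegral_mono' measurableSet_Ioc fun h hh => ?_).trans_lt hi.lintegral_lt_top
    rw [← ofReal_norm, ← ENNReal.ofReal_pow (norm_nonneg _), ← ENNReal.ofReal_mul (by positivity)]
    apply ENNReal.ofReal_le_ofReal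
    have h2 := norm_translateSymbol_sub_one_le h 1
    rw [abs_of_pos hh.1, mul_one, abs_of_pos (by positivity)] at h2
    have h3 : ‖translateSymbol h 1 - 1‖ ^ 2 ≤ (h * (2 * Real.pi)) ^ 2 :=
      pow_le_pow_left₀ (norm_nonneg _) h2 2
    refine (mul_le_mul_of_nonneg_right h3 (Real.rpow_nonneg hh.1.le _)).trans_eq ?_
    rw [show 1 - 2 * σ = 2 + (-1 - 2 * σ) by ring, Real.rpow_add hh.1, Real.rpow_two]
    ring
  · have hi : IntegrableOn (fun h : ℝ => 4 * h ^ (-1 - 2 * σ)) (Set.Ioi 1) :=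
      (integrableOn_Ioi_rpow_of_lt (by linarith) zero_lt_one).const_mul _
    refine (setLIntegral_mono' measurableSet_Ioi fun h hh => ?_).trans_lt hi.lintegral_lt_top
    have h0 : 0 < h := zero_lt_one.trans hh
    rw [← ofReal_norm, ← ENNReal.ofReal_pow (norm_nonneg _), ← ENNReal.ofReal_mul (by positivity)]
    apply ENNReal.ofReal_le_ofReal
    have h2 : ‖translateSymbol h 1 - 1‖ ≤ 2 := by
      refine (norm_sub_le _ _).trans ?_
      rw [norm_translateSymbol, norm_one]
      norm_num
    have h3 : ‖translateSymbol h 1 - 1‖ ^ 2 ≤ 2 ^ 2 := pow_le_pow_left₀ (norm_nonneg _) h2 2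
    refine (mul_le_mul_of_nonneg_right h3 (Real.rpow_nonneg h0.le _)).trans_eq ?_
    norm_num

section Differences

variable {φ₁ φ₂ : ℝ → ℝ≥0∞}

/-- Integrate the hypothesis in t against the Gagliardo weight, exchange the integrals by Tonelli,
and cancel the constant, which is neither 0 nor ∞. -/
theorem lintegral_rpow_mul_le_of_lt_one (h1 : AEMeasurable φ₁) (h2 : AEMeasurable φ₂)
    (h : ∀ t : ℝ, ∫⁻ η, ‖translateSymbol t η - 1‖ₑ ^ 2 * φ₁ η
      ≤ ∫⁻ η, ‖translateSymbol t η - 1‖ₑ ^ 2 * φ₂ η) {σ : ℝ} (hσ : 0 < σ) (hσ' : σ < 1) :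
    ∫⁻ η, ENNReal.ofReal (|η| ^ (2 * σ)) * φ₁ η ≤ ∫⁻ η, ENNReal.ofReal (|η| ^ (2 * σ)) * φ₂ η := by
  have key : ∀ φ : ℝ → ℝ≥0∞, AEMeasurable φ →
      gagliardoConst σ * ∫⁻ η, ENNReal.ofReal (|η| ^ (2 * σ)) * φ η
        = ∫⁻ t, gagliardoWeight σ t * ∫⁻ η, ‖translateSymbol t η - 1‖ₑ ^ 2 * φ η := by
    intro φ hφ
    have hm : ∀ η : ℝ, Measurable fun t => ‖translateSymbol t η - 1‖ₑ ^ 2 * gagliardoWeight σ t := by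
      intro η
      refine Measurable.mul ?_ (measurable_gagliardoWeight σ)
      have : Continuous fun h : ℝ => translateSymbol h η :=
        continuous_translateSymbol.comp (by fun_prop : Continuous fun h : ℝ => (h, η))
      exact ((this.sub continuous_const).enorm.measurable).pow_const 2
    have hm2 : ∀ t : ℝ, Measurable fun η => ‖translateSymbol t η - 1‖ₑ ^ 2 := by
      intro t
      have := (contDiff_translateSymbol t).continuous
      exact ((this.sub continuous_const).enorm.measurable).pow_const 2
    calc gagliardoConst σ * ∫⁻ η, ENNReal.ofReal (|η| ^ (2 * σ)) * φ η
        = ∫⁻ η, ∫⁻ t, ‖translateSymbol t η - 1‖ₑ ^ 2 * gagliardoWeight σ t * φ η := by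
          rw [← lintegral_const_mul'' _ (by fun_prop)]
          congr 1
          ext η
          rw [lintegral_mul_const _ (hm η), lintegral_gagliardo hσ]
          ring
      _ = ∫⁻ t, ∫⁻ η, ‖translateSymbol t η - 1‖ₑ ^ 2 * gagliardoWeight σ t * φ η := by
          apply lintegral_lintegral_swap
          refine AEMeasurable.mul (Measurable.aemeasurable (Measurable.mul ?_ ?_)) ?_
          · have : Continuous fun q : ℝ × ℝ => translateSymbol q.2 q.1 :=
              continuous_translateSymbol.comp continuous_swap
            exact ((this.sub continuous_const).enorm.measurable).pow_const 2
          · exact (measurable_gagliardoWeight σ).comp measurable_snd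
          · exact hφ.comp_quasiMeasurePreserving Measure.quasiMeasurePreserving_fst
      _ = _ := by
          congr 1
          ext t
          rw [← lintegral_const_mul'' (f := fun η => ‖translateSymbol t η - 1‖ₑ ^ 2 * φ η) _
            ((hm2 t).aemeasurable.mul hφ)]
          congr 1
          ext η
          ring
  have h3 : gagliardoConst σ * ∫⁻ η, ENNReal.ofReal (|η| ^ (2 * σ)) * φ₁ η
      ≤ gagliardoConst σ * ∫⁻ η, ENNReal.ofReal (|η| ^ (2 * σ)) * φ₂ η := by
    rw [key φ₁ h1, key φ₂ h2]
    exact lintegral_mono fun t => mul_le_mul_right (h t) _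
  exact (ENNReal.mul_le_mul_iff_right (gagliardoConst_ne_zero σ)
    (gagliardoConst_ne_top hσ hσ')).1 h3

/-- At the endpoint σ = 1 the Gagliardo integral diverges. Difference quotients with steps 1/(n+1)
replace it: Fatou on the left, and on the right the bound |e^(itξ) - 1| ≤ |tξ|. -/
theorem lintegral_sq_mul_le (h1 : AEMeasurable φ₁)
    (h : ∀ t : ℝ, ∫⁻ η, ‖translateSymbol t η - 1‖ₑ ^ 2 * φ₁ η
      ≤ ∫⁻ η, ‖translateSymbol t η - 1‖ₑ ^ 2 * φ₂ η) :
    ∫⁻ η, ENNReal.ofReal (|2 * Real.pi * η| ^ 2) * φ₁ η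
      ≤ ∫⁻ η, ENNReal.ofReal (|2 * Real.pi * η| ^ 2) * φ₂ η := by
  set q : ℕ → ℝ → ℝ≥0∞ := fun n η =>
    ENNReal.ofReal (((n : ℝ) + 1) ^ 2) * ‖translateSymbol (1 / ((n : ℝ) + 1)) η - 1‖ₑ ^ 2 with hq
  have hqm : ∀ n, Measurable (q n) := by
    intro n
    have := (contDiff_translateSymbol (1 / ((n : ℝ) + 1))).continuous
    exact measurable_const.mul (((this.sub continuous_const).enorm.measurable).pow_const 2)
  have hqr : ∀ n η, q n η
      = ENNReal.ofReal ((((n : ℝ) + 1) * ‖translateSymbol (1 / ((n : ℝ) + 1)) η - 1‖) ^ 2) := by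
    intro n η
    rw [hq, mul_pow, ENNReal.ofReal_mul (by positivity), ENNReal.ofReal_pow (norm_nonneg _),
      ofReal_norm]
  have hle : ∀ n η, q n η ≤ ENNReal.ofReal (|2 * Real.pi * η| ^ 2) := by
    intro n η
    rw [hqr]
    apply ENNReal.ofReal_le_ofReal
    refine pow_le_pow_left₀ (by positivity) ?_ 2
    have h2 := norm_translateSymbol_sub_one_le (1 / ((n : ℝ) + 1)) η
    have hn : (0 : ℝ) < (n : ℝ) + 1 := by positivity
    rw [abs_of_pos (by positivity : (0 : ℝ) < 1 / ((n : ℝ) + 1))] at h2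
    calc _ ≤ ((n : ℝ) + 1) * (1 / ((n : ℝ) + 1) * |2 * Real.pi * η|) :=
          mul_le_mul_of_nonneg_left h2 hn.le
      _ = _ := by field_simp
  have hlim : ∀ η, Tendsto (fun n => q n η) atTop (𝓝 (ENNReal.ofReal (|2 * Real.pi * η| ^ 2))) := by
    intro η
    simp only [hqr]
    refine ENNReal.tendsto_ofReal (Tendsto.pow ?_ 2)
    have hd : HasDerivAt (fun t : ℝ => translateSymbol t η) (derivSymbol η) 0 := by
      have h2 : HasDerivAt (fun t : ℝ => (t : ℂ) * derivSymbol η) (derivSymbol η) 0 := by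
        simpa using (Complex.ofRealCLM.hasDerivAt (x := (0 : ℝ))).mul_const (derivSymbol η)
      have h3 := h2.cexp
      simp only [Complex.ofReal_zero, zero_mul, Complex.exp_zero, one_mul] at h3
      refine h3.congr_of_eventuallyEq (Eventually.of_forall fun t => ?_)
      simp only [translateSymbol, derivSymbol]
      ring_nf
    have h4 := hd.tendsto_slope_zero_right
    have h5 : Tendsto (fun n : ℕ => 1 / ((n : ℝ) + 1)) atTop (𝓝[>] 0) :=
      tendsto_nhdsWithin_iff.2 ⟨tendsto_one_div_add_atTop_nhds_zero_nat,
        Eventually.of_forall fun n => Set.mem_Ioi.2 (by positivity)⟩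
    have h6 := (h4.comp h5).norm
    rw [norm_derivSymbol] at h6
    refine h6.congr fun n => ?_
    have h0 : translateSymbol 0 η = 1 := by simp [translateSymbol]
    simp only [Function.comp, zero_add, h0, norm_smul, one_div, inv_inv]
    rw [Real.norm_of_nonneg (by positivity)]
  calc ∫⁻ η, ENNReal.ofReal (|2 * Real.pi * η| ^ 2) * φ₁ η
      = ∫⁻ η, liminf (fun n => q n η * φ₁ η) atTop := by
        apply lintegral_congr_ae
        refine ae_of_all _ fun η => ?_
        -- Where the limit weight is 0 and φ₁ may be ∞ the product need not be continuous, but at η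
        -- = 0 all quotients vanish.
        rcases eq_or_ne η 0 with rfl | hη
        · have h0 : ∀ n, q n 0 = 0 := fun n => by simpa using hle n 0
          simp [h0]
        refine ((ENNReal.Tendsto.mul_const (hlim η) (Or.inl ?_)).liminf_eq).symm
        simpa using hη
    _ ≤ liminf (fun n => ∫⁻ η, q n η * φ₁ η) atTop :=
        lintegral_liminf_le' fun n => (hqm n).aemeasurable.mul h1
    _ ≤ ∫⁻ η, ENNReal.ofReal (|2 * Real.pi * η| ^ 2) * φ₂ η := by
        refine liminf_le_of_le (by isBoundedDefault) fun b hb => ?_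
        obtain ⟨n, hn⟩ := hb.exists
        refine hn.trans ?_
        calc ∫⁻ η, q n η * φ₁ η
            = ENNReal.ofReal (((n : ℝ) + 1) ^ 2)
              * ∫⁻ η, ‖translateSymbol (1 / ((n : ℝ) + 1)) η - 1‖ₑ ^ 2 * φ₁ η := by
              rw [← lintegral_const_mul' _ _ ENNReal.ofReal_ne_top]
              simp only [hq, mul_assoc]
          _ ≤ ENNReal.ofReal (((n : ℝ) + 1) ^ 2)
              * ∫⁻ η, ‖translateSymbol (1 / ((n : ℝ) + 1)) η - 1‖ₑ ^ 2 * φ₂ η :=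
              mul_le_mul_right (h _) _
          _ = ∫⁻ η, q n η * φ₂ η := by
              rw [← lintegral_const_mul' _ _ ENNReal.ofReal_ne_top]
              simp only [hq, mul_assoc]
          _ ≤ _ := lintegral_mono fun η => mul_le_mul_left (hle n η) _

theorem lintegral_rpow_mul_le (h1 : AEMeasurable φ₁) (h2 : AEMeasurable φ₂)
    (h : ∀ t : ℝ, ∫⁻ η, ‖translateSymbol t η - 1‖ₑ ^ 2 * φ₁ η
      ≤ ∫⁻ η, ‖translateSymbol t η - 1‖ₑ ^ 2 * φ₂ η) {σ : ℝ} (hσ : 0 < σ) (hσ' : σ ≤ 1) :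
    ∫⁻ η, ENNReal.ofReal (|2 * Real.pi * η| ^ (2 * σ)) * φ₁ η
      ≤ ∫⁻ η, ENNReal.ofReal (|2 * Real.pi * η| ^ (2 * σ)) * φ₂ η := by
  rcases hσ'.lt_or_eq with hlt | rfl
  · have e : ∀ φ : ℝ → ℝ≥0∞, ∫⁻ η, ENNReal.ofReal (|2 * Real.pi * η| ^ (2 * σ)) * φ η
        = ENNReal.ofReal ((2 * Real.pi) ^ (2 * σ)) *
          ∫⁻ η, ENNReal.ofReal (|η| ^ (2 * σ)) * φ η := by
      intro φ
      rw [← lintegral_const_mul' _ _ ENNReal.ofReal_ne_top]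
      congr 1
      ext η
      rw [← mul_assoc, ← ENNReal.ofReal_mul (by positivity), abs_mul,
        abs_of_pos (by positivity : 0 < 2 * Real.pi), Real.mul_rpow (by positivity) (abs_nonneg _)]
    rw [e, e]
    exact mul_le_mul_right (lintegral_rpow_mul_le_of_lt_one h1 h2 h hσ hlt) _
  · simpa only [mul_one, Real.rpow_two] using lintegral_sq_mul_le h1 h

end Differences

theorem abs_rpow_le_one_add_sq_rpow {σ : ℝ} (hσ : 0 ≤ σ) (y : ℝ) :
    |y| ^ (2 * σ) ≤ (1 + y ^ 2) ^ σ := by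
  rw [Real.rpow_mul (abs_nonneg y), Real.rpow_two, sq_abs]
  exact Real.rpow_le_rpow (sq_nonneg y) (by linarith) hσ

theorem one_add_sq_rpow_le {σ : ℝ} (hσ : 0 ≤ σ) (hσ' : σ ≤ 1) (y : ℝ) :
    (1 + y ^ 2) ^ σ ≤ 1 + |y| ^ (2 * σ) := by
  rw [Real.rpow_mul (abs_nonneg y), Real.rpow_two, sq_abs]
  simpa using Real.rpow_add_le_add_rpow zero_le_one (sq_nonneg y) hσ hσ'

/-- Functions whose differences are dominated by the differences of an `H^σ` function,
`0 ≤ σ ≤ 1`, are in `H^σ`. -/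
theorem mem_sobolev_of_norm_translate_sub_le {σ K : ℝ} (hσ : 0 ≤ σ) (hσ' : σ ≤ 1) (hK : 0 ≤ K)
    {F u : RealL2} (hu : u ∈ sobolev σ) (hF : ‖F‖ ≤ K * ‖u‖)
    (h : ∀ t, ‖translate t F - F‖ ≤ K * ‖translate t u - u‖) :
    F ∈ sobolev σ ∧ ‖lift σ F‖ ≤ 2 * K * ‖lift σ u‖ := by
  set φ : RealL2 → ℝ → ℝ≥0∞ := fun f η => ‖(𝓕 (toComplex f) : ComplexL2) η‖ₑ ^ 2 with hφ
  have hm : ∀ f, AEMeasurable (φ f) := fun f =>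
    ((Lp.aestronglyMeasurable (𝓕 (toComplex f) : ComplexL2)).enorm).pow_const 2
  have hL2 : ∀ f, ∫⁻ η, φ f η = ‖f‖ₑ ^ 2 := by
    intro f
    rw [← enorm_sq_eq_lintegral, ← ofReal_norm, Lp.norm_fourier_eq, norm_toComplex, ofReal_norm]
  have hK2 : ∀ x y : RealL2, ‖x‖ ≤ K * ‖y‖ →
      ‖x‖ₑ ^ 2 ≤ ENNReal.ofReal (K ^ 2) * ‖y‖ₑ ^ 2 := by
    intro x y hxy
    rw [ENNReal.ofReal_pow hK, ← mul_pow, ← ofReal_norm, ← ofReal_norm, ← ENNReal.ofReal_mul hK]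
    exact pow_le_pow_left' (ENNReal.ofReal_le_ofReal hxy) 2
  have a1 : ∫⁻ η, φ F η ≤ ENNReal.ofReal (K ^ 2) * ∫⁻ η, φ u η := by
    rw [hL2, hL2]
    exact hK2 _ _ hF
  have a2 : ∫⁻ η, ENNReal.ofReal (|2 * Real.pi * η| ^ (2 * σ)) * φ F η
      ≤ ENNReal.ofReal (K ^ 2) * ∫⁻ η, ENNReal.ofReal (|2 * Real.pi * η| ^ (2 * σ)) * φ u η := by
    rcases hσ.eq_or_lt with rfl | hpos
    · simpa using a1
    have := lintegral_rpow_mul_le (hm F) ((hm u).const_mul (ENNReal.ofReal (K ^ 2))) (fun t => by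
      have e := hK2 _ _ (h t)
      rw [enorm_translate_sub_sq, enorm_translate_sub_sq,
        ← lintegral_const_mul' _ _ ENNReal.ofReal_ne_top] at e
      refine e.trans_eq (lintegral_congr fun η => ?_)
      simp only [hφ]
      ring) hpos hσ'
    refine this.trans_eq ?_
    rw [← lintegral_const_mul' _ _ ENNReal.ofReal_ne_top]
    refine lintegral_congr fun η => ?_
    ring
  -- The inhomogeneous weight is at most 1 + |ξ|^(2σ), and each of these two terms is at most that
  -- weight; the total factor 2K² is rounded up to (2K)².
  have a3 : ∫⁻ η, ENNReal.ofReal ((1 + (2 * Real.pi * η) ^ 2) ^ σ) * φ F η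
      ≤ ENNReal.ofReal ((2 * K) ^ 2)
        * ∫⁻ η, ENNReal.ofReal ((1 + (2 * Real.pi * η) ^ 2) ^ σ) * φ u η := by
    calc ∫⁻ η, ENNReal.ofReal ((1 + (2 * Real.pi * η) ^ 2) ^ σ) * φ F η
        ≤ ∫⁻ η, (φ F η + ENNReal.ofReal (|2 * Real.pi * η| ^ (2 * σ)) * φ F η) := by
          refine lintegral_mono fun η => ?_
          rw [← one_add_mul, ← ENNReal.ofReal_one, ← ENNReal.ofReal_add zero_le_one (by positivity)]
          exact mul_le_mul_left (ENNReal.ofReal_le_ofReal (one_add_sq_rpow_le hσ hσ' _)) _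
      _ = (∫⁻ η, φ F η) + ∫⁻ η, ENNReal.ofReal (|2 * Real.pi * η| ^ (2 * σ)) * φ F η :=
          lintegral_add_left' (hm F) _
      _ ≤ _ := add_le_add a1 a2
      _ ≤ (ENNReal.ofReal (K ^ 2) * ∫⁻ η, ENNReal.ofReal ((1 + (2 * Real.pi * η) ^ 2) ^ σ) * φ u η)
          + ENNReal.ofReal (K ^ 2)
            * ∫⁻ η, ENNReal.ofReal ((1 + (2 * Real.pi * η) ^ 2) ^ σ) * φ u η := by
          refine add_le_add (mul_le_mul_right (lintegral_mono fun η => ?_) _)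
            (mul_le_mul_right (lintegral_mono fun η => ?_) _)
          · refine le_mul_of_one_le_left' ?_
            rw [← ENNReal.ofReal_one]
            refine ENNReal.ofReal_le_ofReal (Real.one_le_rpow ?_ hσ)
            linarith [sq_nonneg (2 * Real.pi * η)]
          · exact mul_le_mul_left (ENNReal.ofReal_le_ofReal (abs_rpow_le_one_add_sq_rpow hσ _)) _
      _ ≤ _ := by
          rw [← add_mul, ← ENNReal.ofReal_add (by positivity) (by positivity)]
          exact mul_le_mul_left (ENNReal.ofReal_le_ofReal (by nlinarith [sq_nonneg K])) _
  have a4 : sobolevENorm σ F ≤ ENNReal.ofReal (2 * K) * sobolevENorm σ u := by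
    rw [sobolevENorm, sobolevENorm]
    refine (ENNReal.rpow_le_rpow a3 (by norm_num)).trans_eq ?_
    rw [ENNReal.mul_rpow_of_nonneg _ _ (by norm_num), ENNReal.ofReal_pow (by positivity),
      ← ENNReal.rpow_two, ← ENNReal.rpow_mul]
    norm_num [hφ]
  have hFm : F ∈ sobolev σ := a4.trans_lt (ENNReal.mul_lt_top ENNReal.ofReal_lt_top hu)
  refine ⟨hFm, ?_⟩
  rw [← enorm_lift hFm, ← enorm_lift hu, ← ofReal_norm, ← ofReal_norm,
    ← ENNReal.ofReal_mul (by positivity)] at a4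
  exact (ENNReal.ofReal_le_ofReal_iff (by positivity)).1 a4

/-! ### The power nonlinearity -/

theorem abs_abs_rpow_mul_self {p : ℝ} (hp : 1 < p) (a : ℝ) : |(|a| ^ (p - 1) * a)| = |a| ^ p := by
  rw [abs_mul, abs_of_nonneg (Real.rpow_nonneg (abs_nonneg a) _)]
  nth_rewrite 2 [← Real.rpow_one |a|]
  rw [← Real.rpow_add_of_nonneg (abs_nonneg a) (by linarith) zero_le_one, sub_add_cancel]

theorem abs_rpow_mul_self_mul_self {p : ℝ} (hp : 1 < p) (a : ℝ) :
    |a| ^ (p - 1) * a * a = |a| ^ (p + 1) := by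
  rw [mul_assoc, ← sq, ← sq_abs, ← Real.rpow_natCast,
    ← Real.rpow_add_of_nonneg (abs_nonneg a) (by linarith) (by norm_num)]
  congr 1
  push_cast
  ring

theorem abs_abs_rpow_sub_le {p M : ℝ} (hp : 1 < p) {a b : ℝ} (ha : |a| ≤ M) (hb : |b| ≤ M) :
    |(|a| ^ p - |b| ^ p)| ≤ p * M ^ (p - 1) * |a - b| := by
  refine (convex_Icc (-M) M).norm_image_sub_le_of_norm_hasDerivWithin_le (f := fun x => |x| ^ p)
    (f' := fun x => p * |x| ^ (p - 2) * x)
    (fun x _ => (hasDerivAt_abs_rpow x hp).hasDerivWithinAt) (fun x hx => ?_)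
    (abs_le.1 hb) (abs_le.1 ha)
  rcases eq_or_ne x 0 with rfl | hx0
  · simp only [mul_zero, norm_zero]
    have : 0 ≤ M := (abs_nonneg a).trans ha
    positivity
  have hpos : 0 < |x| := abs_pos.2 hx0
  have e : ‖p * |x| ^ (p - 2) * x‖ = p * |x| ^ (p - 1) := by
    rw [norm_mul, norm_mul, Real.norm_of_nonneg (by linarith),
      Real.norm_of_nonneg (Real.rpow_nonneg hpos.le _), Real.norm_eq_abs, mul_assoc]
    nth_rewrite 2 [← Real.rpow_one |x|]
    rw [← Real.rpow_add hpos]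
    ring_nf
  rw [e]
  exact mul_le_mul_of_nonneg_left (Real.rpow_le_rpow hpos.le (abs_le.2 hx) (by linarith))
    (by linarith)

theorem abs_rpow_mul_self_of_nonneg {p : ℝ} (hp : 1 < p) {a : ℝ} (ha : 0 ≤ a) :
    |a| ^ (p - 1) * a = |a| ^ p := by
  rw [← abs_abs_rpow_mul_self hp, abs_of_nonneg (a := |a| ^ (p - 1) * a) (by positivity)]

theorem abs_rpow_mul_self_of_nonpos {p : ℝ} (hp : 1 < p) {a : ℝ} (ha : a ≤ 0) :
    |a| ^ (p - 1) * a = -|a| ^ p := by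
  rw [← abs_abs_rpow_mul_self hp, abs_of_nonpos (a := |a| ^ (p - 1) * a), neg_neg]
  exact mul_nonpos_of_nonneg_of_nonpos (by positivity) ha

theorem abs_rpow_le_mul {p M : ℝ} (hp : 1 < p) {a : ℝ} (ha : |a| ≤ M) :
    |a| ^ p ≤ M ^ (p - 1) * |a| := by
  rw [← abs_abs_rpow_mul_self hp, abs_mul, abs_of_nonneg (Real.rpow_nonneg (abs_nonneg a) _)]
  exact mul_le_mul_of_nonneg_right (Real.rpow_le_rpow (abs_nonneg a) ha (by linarith))
    (abs_nonneg a)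

/-- For equal signs this is the estimate for |·|^p; for opposite signs |a - b| = |a| + |b| and each
power is bounded separately. -/
theorem abs_rpow_mul_self_sub_le {p M : ℝ} (hp : 1 < p) {a b : ℝ} (ha : |a| ≤ M) (hb : |b| ≤ M) :
    |(|a| ^ (p - 1) * a - |b| ^ (p - 1) * b)| ≤ p * M ^ (p - 1) * |a - b| := by
  have hM : 0 ≤ M := (abs_nonneg a).trans ha
  have h1 := abs_abs_rpow_sub_le hp ha hb
  have opp : ∀ {a b : ℝ}, |a| ≤ M → |b| ≤ M → 0 ≤ a → b ≤ 0 →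
      |a| ^ p + |b| ^ p ≤ p * M ^ (p - 1) * |a - b| := by
    intro a b ha hb h2 h3
    have e : |a - b| = |a| + |b| := by
      rw [abs_of_nonneg h2, abs_of_nonpos h3, abs_of_nonneg (by linarith)]
      ring
    have h4 := abs_rpow_le_mul hp ha
    have h5 := abs_rpow_le_mul hp hb
    have h6 : 0 ≤ M ^ (p - 1) * (|a| + |b|) := by positivity
    rw [e]
    nlinarith
  rcases le_total 0 a with h2 | h2 <;> rcases le_total 0 b with h3 | h3
  · rwa [abs_rpow_mul_self_of_nonneg hp h2, abs_rpow_mul_self_of_nonneg hp h3]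
  · rw [abs_rpow_mul_self_of_nonneg hp h2, abs_rpow_mul_self_of_nonpos hp h3, sub_neg_eq_add,
      abs_of_nonneg (by positivity)]
    exact opp ha hb h2 h3
  · rw [abs_rpow_mul_self_of_nonpos hp h2, abs_rpow_mul_self_of_nonneg hp h3,
      abs_sub_comm, sub_neg_eq_add, abs_of_nonneg (by positivity), abs_sub_comm a]
    exact opp hb ha h3 h2
  · rw [abs_rpow_mul_self_of_nonpos hp h2, abs_rpow_mul_self_of_nonpos hp h3, abs_sub_comm]
    convert h1 using 2
    ring

/-- The subgradient inequality for |x|^(p+1)/(p+1), obtained from Young's inequality with exponents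
p + 1 and (p + 1)/p. -/
theorem mul_sub_le_abs_rpow_sub {p : ℝ} (hp : 1 < p) (a b : ℝ) :
    |a| ^ (p - 1) * a * (b - a) ≤ 1 / (p + 1) * (|b| ^ (p + 1) - |a| ^ (p + 1)) := by
  have hconj : (p + 1).HolderConjugate ((p + 1) / p) := by
    have := Real.HolderConjugate.conjExponent (p := p + 1) (by linarith)
    convert this using 1
    simp [Real.conjExponent]
  have hy := Real.young_inequality_of_nonneg (abs_nonneg b)
    (Real.rpow_nonneg (abs_nonneg a) p) hconj
  rw [← Real.rpow_mul (abs_nonneg a), mul_div_cancel₀ _ (by linarith : p ≠ 0)] at hy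
  have h1 : |a| ^ (p - 1) * a * b ≤ |b| * |a| ^ p := by
    refine (le_abs_self _).trans_eq ?_
    rw [abs_mul, abs_abs_rpow_mul_self hp, mul_comm]
  have h2 := abs_rpow_mul_self_mul_self hp a
  have h3 : |a| ^ (p + 1) / ((p + 1) / p) = |a| ^ (p + 1) - 1 / (p + 1) * |a| ^ (p + 1) := by
    have : p + 1 ≠ 0 := by linarith
    field_simp
    ring
  have h4 : |b| ^ (p + 1) / (p + 1) = 1 / (p + 1) * |b| ^ (p + 1) := by ring
  rw [h3, h4] at hy
  rw [mul_sub, h2, mul_sub]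
  linarith

theorem continuous_abs_rpow_mul_self {p : ℝ} (hp : 1 < p) :
    Continuous fun a : ℝ => |a| ^ (p - 1) * a :=
  (continuous_abs.rpow_const fun _ => Or.inr (by linarith)).mul continuous_id

section Bounded

variable {p M : ℝ} {u v : RealL2}

theorem memLp_powerNonlinearity (hp : 1 < p) (hu : ∀ᵐ x, |u x| ≤ M) :
    MemLp (fun x : ℝ => -(|u x| ^ (p - 1) * u x)) 2 volume := by
  refine ((Lp.memLp u).of_le_mul (c := M ^ (p - 1)) ?_ ?_).neg
  · exact (continuous_abs_rpow_mul_self hp).comp_aestronglyMeasurable (Lp.aestronglyMeasurable u)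
  · filter_upwards [hu] with x hx
    rw [Real.norm_eq_abs, abs_abs_rpow_mul_self hp, Real.norm_eq_abs]
    exact abs_rpow_le_mul hp hx

theorem powerNonlinearity_ae (hp : 1 < p) (hu : ∀ᵐ x, |u x| ≤ M) :
    powerNonlinearity p u =ᵐ[volume] fun x => -(|u x| ^ (p - 1) * u x) := by
  rw [powerNonlinearity, dif_pos (memLp_powerNonlinearity hp hu)]
  exact MemLp.coeFn_toLp _

theorem norm_powerNonlinearity_le (hp : 1 < p) (hu : ∀ᵐ x, |u x| ≤ M) :
    ‖powerNonlinearity p u‖ ≤ M ^ (p - 1) * ‖u‖ := by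
  refine Lp.norm_le_mul_norm_of_ae_le_mul ?_
  filter_upwards [powerNonlinearity_ae hp hu, hu] with x h1 h2
  rw [h1, norm_neg, Real.norm_eq_abs, abs_abs_rpow_mul_self hp]
  exact abs_rpow_le_mul hp h2

theorem norm_powerNonlinearity_sub_le (hp : 1 < p) (hu : ∀ᵐ x, |u x| ≤ M) (hv : ∀ᵐ x, |v x| ≤ M) :
    ‖powerNonlinearity p u - powerNonlinearity p v‖ ≤ p * M ^ (p - 1) * ‖u - v‖ := by
  refine Lp.norm_le_mul_norm_of_ae_le_mul ?_
  filter_upwards [powerNonlinearity_ae hp hu, powerNonlinearity_ae hp hv, hu, hv,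
    Lp.coeFn_sub u v, Lp.coeFn_sub (powerNonlinearity p u) (powerNonlinearity p v)]
    with x h1 h2 h3 h4 h5 h6
  rw [h5, h6, Pi.sub_apply, Pi.sub_apply, h1, h2, neg_sub_neg, norm_sub_rev]
  exact abs_rpow_mul_self_sub_le hp h3 h4

/-- The nonlinearity commutes with translations, so its Lipschitz bound applies to u and its
translate, which share the bound M. -/
theorem norm_translate_powerNonlinearity_sub_le (hp : 1 < p) (hu : ∀ᵐ x, |u x| ≤ M) (t : ℝ) :
    ‖translate t (powerNonlinearity p u) - powerNonlinearity p u‖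
      ≤ p * M ^ (p - 1) * ‖translate t u - u‖ := by
  have hqmp := (measurePreserving_add_right (volume : Measure ℝ) t).quasiMeasurePreserving
  have hu' : ∀ᵐ x, |translate t u x| ≤ M := by
    filter_upwards [translate_ae t u, hqmp.ae hu] with x h1 h2
    rwa [h1]
  have e : translate t (powerNonlinearity p u) = powerNonlinearity p (translate t u) := by
    apply Lp.ext
    filter_upwards [translate_ae t (powerNonlinearity p u), powerNonlinearity_ae hp hu',
      hqmp.ae (powerNonlinearity_ae hp hu), translate_ae t u] with x h1 h2 h3 h4
    rw [h1, h2, h3, h4]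
  rw [e]
  exact norm_powerNonlinearity_sub_le hp hu' hu

theorem nonlinearEnergy_eq_inner (hp : 1 < p) (hu : ∀ᵐ x, |u x| ≤ M) :
    nonlinearEnergy p u = -inner ℝ (powerNonlinearity p u) u := by
  rw [L2.inner_def, nonlinearEnergy, ← integral_neg]
  apply integral_congr_ae
  filter_upwards [powerNonlinearity_ae hp hu] with x h1
  rw [h1, ← abs_rpow_mul_self_mul_self hp]
  simp only [RCLike.inner_apply, conj_trivial]
  ring

theorem integrable_abs_rpow (hp : 1 < p) (hu : ∀ᵐ x, |u x| ≤ M) :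
    Integrable fun x => |u x| ^ (p + 1) := by
  refine ((memLp_powerNonlinearity hp hu).neg.integrable_mul (Lp.memLp u)).congr
    (ae_of_all _ fun x => ?_)
  simp only [Pi.mul_apply, Pi.neg_apply, neg_neg]
  exact abs_rpow_mul_self_mul_self hp _

theorem nonlinearEnergy_le (hp : 1 < p) (hu : ∀ᵐ x, |u x| ≤ M) :
    nonlinearEnergy p u ≤ M ^ (p - 1) * ‖u‖ ^ 2 := by
  rw [nonlinearEnergy_eq_inner hp hu]
  refine (neg_le_abs _).trans ((abs_real_inner_le_norm _ _).trans ?_)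
  rw [sq, ← mul_assoc]
  exact mul_le_mul_of_nonneg_right (norm_powerNonlinearity_le hp hu) (norm_nonneg _)

theorem inner_le_nonlinearEnergy_sub (hp : 1 < p) (hu : ∀ᵐ x, |u x| ≤ M) (hv : ∀ᵐ x, |v x| ≤ M) :
    -inner ℝ (powerNonlinearity p u) (v - u)
      ≤ 1 / (p + 1) * (nonlinearEnergy p v - nonlinearEnergy p u) := by
  rw [L2.inner_def, nonlinearEnergy, nonlinearEnergy, ← integral_neg,
    ← integral_sub (integrable_abs_rpow hp hv) (integrable_abs_rpow hp hu), ← integral_const_mul]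
  refine integral_mono_ae (L2.integrable_inner _ _).neg
    (((integrable_abs_rpow hp hv).sub (integrable_abs_rpow hp hu)).const_mul _) ?_
  filter_upwards [powerNonlinearity_ae hp hu, Lp.coeFn_sub v u] with x h1 h2
  rw [h1, h2, Pi.sub_apply]
  have := mul_sub_le_abs_rpow_sub hp (u x) (v x)
  simp only [RCLike.inner_apply, conj_trivial]
  linarith

theorem powerNonlinearity_mem_sobolev (hp : 1 < p) (hM : 0 ≤ M) (hu : ∀ᵐ x, |u x| ≤ M) {σ : ℝ}
    (hσ : 0 ≤ σ) (hσ' : σ ≤ 1) (hs : u ∈ sobolev σ) :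
    powerNonlinearity p u ∈ sobolev σ ∧
      ‖lift σ (powerNonlinearity p u)‖ ≤ 2 * (p * M ^ (p - 1)) * ‖lift σ u‖ := by
  refine mem_sobolev_of_norm_translate_sub_le hσ hσ' (by positivity) hs ?_
    (norm_translate_powerNonlinearity_sub_le hp hu)
  refine (norm_powerNonlinearity_le hp hu).trans ?_
  have : 0 ≤ M ^ (p - 1) * ‖u‖ := by positivity
  nlinarith

end Bounded

/-! ### Admissible symbols and the quadratic part of the energy -/

/-- The hypotheses on the symbols `l`, `b`, of orders `ρ` and `-r`, and on the power `p`. -/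
structure Admissible (l b : ℝ → ℝ) (ρ r p : ℝ) : Prop where
  continuous_l : Continuous l
  continuous_b : Continuous b
  l_lower : ∃ c : ℝ, 0 < c ∧ ∀ η, c * wt ρ η ≤ l (2 * Real.pi * η)
  l_upper : ∃ c : ℝ, 0 < c ∧ ∀ η, l (2 * Real.pi * η) ≤ c * wt ρ η
  b_lower : ∃ c : ℝ, 0 < c ∧ ∀ η, c * wt (-r) η ≤ b (2 * Real.pi * η)
  b_upper : ∃ c : ℝ, 0 < c ∧ ∀ η, b (2 * Real.pi * η) ≤ c * wt (-r) η
  rho_nonneg : 0 ≤ ρ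
  r_nonneg : 0 ≤ r
  one_le : 1 ≤ r + ρ / 2
  half_lt : 1 / 2 < s₀ ρ r
  one_lt_p : 1 < p

variable {l b : ℝ → ℝ} {ρ r p : ℝ}

/-- `b^(-1/2)` at `ξ = 2πη`. -/
def bInvSqrt (b : ℝ → ℝ) (η : ℝ) : ℝ := (b (2 * Real.pi * η)) ^ (-(1 / 2) : ℝ)

/-- `l^(1/2)` at `ξ = 2πη`. -/
def lSqrt (l : ℝ → ℝ) (η : ℝ) : ℝ := (l (2 * Real.pi * η)) ^ (1 / 2 : ℝ)

/-- The symbol relating `⟨ξ⟩^(r/2) ŵ` and `b^(-1/2) ŵ`. -/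
def kineticSymbol (b : ℝ → ℝ) (r η : ℝ) : ℂ := (bInvSqrt b η * wt (-(r / 2)) η : ℝ)

/-- The symbol relating `⟨ξ⟩^s₀ û` and `b^(-1/2) l^(1/2) û`. -/
def dispersiveSymbol (l b : ℝ → ℝ) (ρ r η : ℝ) : ℂ :=
  (bInvSqrt b η * lSqrt l η * wt (-s₀ ρ r) η : ℝ)

namespace Admissible

variable (h : Admissible l b ρ r p)
include h

theorem l_pos (η : ℝ) : 0 < l (2 * Real.pi * η) := by
  obtain ⟨c, hc, hl⟩ := h.l_lower
  exact (mul_pos hc (wt_pos _ _)).trans_le (hl η)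

theorem b_pos (η : ℝ) : 0 < b (2 * Real.pi * η) := by
  obtain ⟨c, hc, hl⟩ := h.b_lower
  exact (mul_pos hc (wt_pos _ _)).trans_le (hl η)

theorem bInvSqrt_pos (η : ℝ) : 0 < bInvSqrt b η := Real.rpow_pos_of_pos (h.b_pos η) _

theorem lSqrt_pos (η : ℝ) : 0 < lSqrt l η := Real.rpow_pos_of_pos (h.l_pos η) _

theorem bInvSqrt_sq (η : ℝ) : bInvSqrt b η ^ 2 * b (2 * Real.pi * η) = 1 := by
  rw [bInvSqrt, ← Real.rpow_natCast, ← Real.rpow_mul (h.b_pos η).le]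
  norm_num
  rw [Real.rpow_neg_one, inv_mul_cancel₀ (h.b_pos η).ne']

theorem lSqrt_sq (η : ℝ) : lSqrt l η ^ 2 = l (2 * Real.pi * η) := by
  rw [lSqrt, ← Real.rpow_natCast, ← Real.rpow_mul (h.l_pos η).le]
  norm_num

theorem continuous_bInvSqrt : Continuous (bInvSqrt b) :=
  (h.continuous_b.comp (by fun_prop)).rpow_const fun η => Or.inl (h.b_pos η).ne'

theorem continuous_lSqrt : Continuous (lSqrt l) :=
  (h.continuous_l.comp (by fun_prop)).rpow_const fun η => Or.inl (h.l_pos η).ne'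

theorem s₀_nonneg : 0 ≤ s₀ ρ r := by linarith [h.half_lt]

theorem bddSymbol_kineticSymbol : BddSymbol (kineticSymbol b r) := by
  obtain ⟨c, hc, hb⟩ := h.b_lower
  refine .of_continuous_of_le (C := Real.sqrt (1 / c)) (Complex.continuous_ofReal.comp
    (h.continuous_bInvSqrt.mul (continuous_wt _))) fun η => ?_
  rw [kineticSymbol, Complex.norm_real]
  apply Real.abs_le_sqrt
  rw [le_div_iff₀ hc, mul_pow, wt_sq, ← wt_sq, sq (wt _ _), ← wt_add]
  have h1 := hb η
  have h2 := h.bInvSqrt_sq η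
  have h3 : 0 ≤ bInvSqrt b η ^ 2 := sq_nonneg _
  rw [show -(r / 2) + -(r / 2) = -r by ring]
  nlinarith

theorem dispersiveSymbol_sq (η : ℝ) :
    (bInvSqrt b η * lSqrt l η * wt (-s₀ ρ r) η) ^ 2
      = bInvSqrt b η ^ 2 * (l (2 * Real.pi * η) * wt (-ρ) η * wt (-r) η) := by
  rw [mul_pow, mul_pow, h.lSqrt_sq, sq (wt _ _), ← wt_add, mul_assoc, mul_assoc, mul_assoc, ← wt_add]
  congr 3
  rw [s₀]
  ring_nf

theorem bddSymbol_dispersiveSymbol : BddSymbol (dispersiveSymbol l b ρ r) := by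
  obtain ⟨c, hc, hb⟩ := h.b_lower
  obtain ⟨C, hC, hl⟩ := h.l_upper
  refine .of_continuous_of_le (C := Real.sqrt (C / c)) (Complex.continuous_ofReal.comp
    ((h.continuous_bInvSqrt.mul h.continuous_lSqrt).mul (continuous_wt _))) fun η => ?_
  rw [dispersiveSymbol, Complex.norm_real]
  apply Real.abs_le_sqrt
  rw [le_div_iff₀ hc, h.dispersiveSymbol_sq]
  have h1 := hb η
  have h2 := h.bInvSqrt_sq η
  have h3 : 0 ≤ bInvSqrt b η ^ 2 := sq_nonneg _
  have h4 : l (2 * Real.pi * η) * wt (-ρ) η ≤ C := by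
    have := mul_le_mul_of_nonneg_right (hl η) (wt_pos (-ρ) η).le
    rwa [mul_assoc C (wt ρ η), wt_mul_neg, mul_one] at this
  have h5 := (wt_pos (-r) η).le
  calc bInvSqrt b η ^ 2 * (l (2 * Real.pi * η) * wt (-ρ) η * wt (-r) η) * c
      = l (2 * Real.pi * η) * wt (-ρ) η * (bInvSqrt b η ^ 2 * (c * wt (-r) η)) := by ring
    _ ≤ C * (bInvSqrt b η ^ 2 * (c * wt (-r) η)) := by gcongr
    _ ≤ C * (bInvSqrt b η ^ 2 * b (2 * Real.pi * η)) := by gcongr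
    _ = C := by rw [h2, mul_one]

/-- Coercivity of I on H^s₀: l is bounded below at order ρ, 1/b at order r, and 2s₀ = ρ + r. -/
theorem exists_norm_le_mulOp_dispersiveSymbol : ∃ D : ℝ, 0 < D ∧
    ∀ x : ComplexL2, ‖x‖ ≤ D * ‖mulOp (dispersiveSymbol l b ρ r) x‖ := by
  obtain ⟨c, hc, hb⟩ := h.b_upper
  obtain ⟨C, hC, hl⟩ := h.l_lower
  refine ⟨Real.sqrt (c / C), Real.sqrt_pos.2 (by positivity), fun x => ?_⟩
  refine Lp.norm_le_mul_norm_of_ae_le_mul ?_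
  filter_upwards [mulOp_ae h.bddSymbol_dispersiveSymbol x] with η hη
  have hp : 0 < bInvSqrt b η * lSqrt l η * wt (-s₀ ρ r) η :=
    mul_pos (mul_pos (h.bInvSqrt_pos η) (h.lSqrt_pos η)) (wt_pos _ _)
  rw [hη, norm_mul, dispersiveSymbol, Complex.norm_real, Real.norm_of_nonneg hp.le, ← mul_assoc]
  refine le_mul_of_one_le_left (norm_nonneg _) ?_
  rw [← Real.sqrt_sq hp.le, ← Real.sqrt_mul (by positivity), Real.one_le_sqrt,
    h.dispersiveSymbol_sq]
  have h1 := hb η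
  have h2 := h.bInvSqrt_sq η
  have h3 : 0 ≤ bInvSqrt b η ^ 2 := sq_nonneg _
  have h4 : C ≤ l (2 * Real.pi * η) * wt (-ρ) η := by
    have := mul_le_mul_of_nonneg_right (hl η) (wt_pos (-ρ) η).le
    rwa [mul_assoc C (wt ρ η), wt_mul_neg, mul_one] at this
  have h5 := (wt_pos (-r) η).le
  rw [div_mul_eq_mul_div, le_div_iff₀ hC, one_mul]
  calc C = C * (bInvSqrt b η ^ 2 * b (2 * Real.pi * η)) := by rw [h2, mul_one]
    _ ≤ C * (bInvSqrt b η ^ 2 * (c * wt (-r) η)) := by gcongr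
    _ ≤ l (2 * Real.pi * η) * wt (-ρ) η * (bInvSqrt b η ^ 2 * (c * wt (-r) η)) := by gcongr
    _ = _ := by ring

end Admissible

/-- Exhibiting an L² representative of m f̂ places f in the domain and rules out the default value
0. -/
theorem multiplier_eq {m : ℝ → ℝ} {f x : ComplexL2}
    (hx : x =ᵐ[volume] fun η => (m (2 * Real.pi * η) : ℂ) * (𝓕 f : ComplexL2) η) :
    multiplier m f = 𝓕⁻ x := by
  have hm : MemLp (fun η : ℝ => (m (2 * Real.pi * η) : ℂ) * (𝓕 f : ComplexL2) η) 2 volume :=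
    (memLp_congr_ae hx).1 (Lp.memLp x)
  rw [multiplier, dif_pos hm]
  congr 1
  exact Lp.ext (hm.coeFn_toLp.trans hx.symm)

theorem norm_fourierInv_eq (x : ComplexL2) : ‖(𝓕⁻ x : ComplexL2)‖ = ‖x‖ :=
  (Lp.fourierTransformₗᵢ ℝ ℂ).symm.norm_map x

theorem lift_ae' {s : ℝ} {f : RealL2} (hf : f ∈ sobolev s) :
    (𝓕 (toComplex f) : ComplexL2) =ᵐ[volume] fun η => (wt (-s) η : ℂ) * lift s f η := by
  filter_upwards [lift_ae hf] with η hη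
  rw [hη, ← mul_assoc, ← Complex.ofReal_mul, wt_neg_mul, Complex.ofReal_one, one_mul]

namespace Admissible

variable (h : Admissible l b ρ r p)
include h

theorem norm_invSqrtB {w : RealL2} (hw : w ∈ sobolev (r / 2)) :
    ‖invSqrtB b (toComplex w)‖ = ‖mulOp (kineticSymbol b r) (lift (r / 2) w)‖ := by
  rw [invSqrtB, multiplier_eq (x := mulOp (kineticSymbol b r) (lift (r / 2) w)),
    norm_fourierInv_eq]
  filter_upwards [mulOp_ae h.bddSymbol_kineticSymbol (lift (r / 2) w), lift_ae' hw] with η h1 h2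
  rw [h1, h2, kineticSymbol, bInvSqrt, ← mul_assoc]
  push_cast
  rfl

theorem norm_invSqrtB_sqrtL {u : RealL2} (hu : u ∈ sobolev (s₀ ρ r)) :
    ‖invSqrtB b (sqrtL l (toComplex u))‖
      = ‖mulOp (dispersiveSymbol l b ρ r) (lift (s₀ ρ r) u)‖ := by
  -- The composition is the product multiplier only if L^(1/2)u itself lies in L², which holds
  -- because ρ/2 ≤ s₀.
  have hbd : BddSymbol fun η => ((lSqrt l η * wt (-s₀ ρ r) η : ℝ) : ℂ) := by
    obtain ⟨C, hC, hl⟩ := h.l_upper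
    refine .of_continuous_of_le (C := Real.sqrt C) (Complex.continuous_ofReal.comp
      (h.continuous_lSqrt.mul (continuous_wt _))) fun η => ?_
    rw [Complex.norm_real]
    apply Real.abs_le_sqrt
    rw [mul_pow, h.lSqrt_sq, sq (wt _ _), ← wt_add]
    calc _ ≤ C * wt ρ η * wt (-s₀ ρ r + -s₀ ρ r) η :=
          mul_le_mul_of_nonneg_right (hl η) (wt_pos _ _).le
      _ = C * wt (-r) η := by
          rw [mul_assoc, ← wt_add, s₀]
          congr 2
          ring
      _ ≤ C * 1 := mul_le_mul_of_nonneg_left (wt_le_one (by linarith [h.r_nonneg]) η) hC.le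
      _ = C := mul_one C
  have e1 : sqrtL l (toComplex u)
      = 𝓕⁻ (mulOp (fun η => ((lSqrt l η * wt (-s₀ ρ r) η : ℝ) : ℂ)) (lift (s₀ ρ r) u)) := by
    apply multiplier_eq
    filter_upwards [mulOp_ae hbd (lift (s₀ ρ r) u), lift_ae' hu] with η h1 h2
    rw [h1, h2, lSqrt, ← mul_assoc]
    push_cast
    rfl
  rw [e1, invSqrtB, multiplier_eq (x := mulOp (dispersiveSymbol l b ρ r) (lift (s₀ ρ r) u)),
    norm_fourierInv_eq]
  rw [FourierTransform.fourier_fourierInv_eq]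
  filter_upwards [mulOp_ae hbd (lift (s₀ ρ r) u),
    mulOp_ae h.bddSymbol_dispersiveSymbol (lift (s₀ ρ r) u)] with η h1 h2
  rw [h1, h2, dispersiveSymbol, bInvSqrt, ← mul_assoc]
  push_cast
  ring

theorem dispersiveEnergy_eq {u : RealL2} (hu : u ∈ sobolev (s₀ ρ r)) :
    dispersiveEnergy l b u
      = 1 / 2 * ‖mulOp (dispersiveSymbol l b ρ r) (lift (s₀ ρ r) u)‖ ^ 2 := by
  rw [dispersiveEnergy, h.norm_invSqrtB_sqrtL hu]

theorem energy_eq {u w : RealL2} (hu : u ∈ sobolev (s₀ ρ r)) (hw : w ∈ sobolev (r / 2)) :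
    energy l b p u w = 1 / 2 * ‖mulOp (kineticSymbol b r) (lift (r / 2) w)‖ ^ 2
      + 1 / 2 * ‖mulOp (dispersiveSymbol l b ρ r) (lift (s₀ ρ r) u)‖ ^ 2
      - 1 / (p + 1) * nonlinearEnergy p u := by
  rw [energy, h.norm_invSqrtB_sqrtL hu, h.norm_invSqrtB hw]

theorem exists_abs_le : ∃ C : ℝ, 0 < C ∧
    ∀ f : RealL2, f ∈ sobolev (s₀ ρ r) → ∀ᵐ x, |f x| ≤ C * ‖lift (s₀ ρ r) f‖ :=
  exists_abs_le_norm_lift h.half_lt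

/-- Near the origin `Q(u) ≤ 2 I(u)`. -/
theorem exists_nonlinearEnergy_le : ∃ δ : ℝ, 0 < δ ∧ ∀ u : RealL2, u ∈ sobolev (s₀ ρ r) →
    ‖lift (s₀ ρ r) u‖ < δ → 0 ≤ 2 * dispersiveEnergy l b u - nonlinearEnergy p u := by
  obtain ⟨C, hC, hsup⟩ := h.exists_abs_le
  obtain ⟨D, hD, hco⟩ := h.exists_norm_le_mulOp_dispersiveSymbol
  have hp := h.one_lt_p
  -- The embedding and coercivity give Q(u) ≤ (C‖u‖)^(p-1) D² · 2I(u) with the H^s₀ norm; as p > 1,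
  -- the factor is below 1 near 0.
  have hcont : Tendsto (fun x : ℝ => (C * x) ^ (p - 1) * D ^ 2) (𝓝 0) (𝓝 0) := by
    have : Continuous fun x : ℝ => (C * x) ^ (p - 1) * D ^ 2 :=
      ((continuous_const.mul continuous_id).rpow_const fun _ => Or.inr (by linarith)).mul
        continuous_const
    simpa [Real.zero_rpow (by linarith : p - 1 ≠ 0)] using this.tendsto 0
  obtain ⟨δ, hδ, hball⟩ := Metric.eventually_nhds_iff.1 (hcont.eventually_lt_const zero_lt_one)
  refine ⟨δ, hδ, fun u hu hlt => ?_⟩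
  have h1 := nonlinearEnergy_le hp (hsup u hu)
  have h2 := norm_le_norm_lift h.s₀_nonneg hu
  have h3 := hco (lift (s₀ ρ r) u)
  have h4 := hball (y := ‖lift (s₀ ρ r) u‖) (by simpa using hlt)
  rw [h.dispersiveEnergy_eq hu]
  set N := ‖mulOp (dispersiveSymbol l b ρ r) (lift (s₀ ρ r) u)‖
  have h5 : ‖u‖ ^ 2 ≤ (D * N) ^ 2 := pow_le_pow_left₀ (norm_nonneg _) (h2.trans h3) 2
  have h6 : 0 ≤ (C * ‖lift (s₀ ρ r) u‖) ^ (p - 1) := by positivity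
  have h7 : nonlinearEnergy p u ≤ ((C * ‖lift (s₀ ρ r) u‖) ^ (p - 1) * D ^ 2) * N ^ 2 := by
    refine h1.trans ((mul_le_mul_of_nonneg_left h5 h6).trans_eq ?_)
    ring
  nlinarith [sq_nonneg N]

end Admissible

/-! ### Energy conservation -/

variable {T : EReal} {u w : ℝ → RealL2}

/-- The times `0 < t < T`. -/
def openTimes (T : EReal) : Set ℝ := {t : ℝ | 0 < t ∧ (t : EReal) < T}

theorem isOpen_openTimes (T : EReal) : IsOpen (openTimes T) :=
  isOpen_Ioi.inter (isOpen_Iio.preimage continuous_coe_real_ereal)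

theorem ordConnected_openTimes (T : EReal) : (openTimes T).OrdConnected :=
  ⟨fun _ hx _ hy _ hz => ⟨hx.1.trans_le hz.1, (EReal.coe_le_coe_iff.2 hz.2).trans_lt hy.2⟩⟩

theorem openTimes_subset (T : EReal) : openTimes T ⊆ timeInterval T := fun _ h => ⟨h.1.le, h.2⟩

/-- The order of regularity of `g(u)`. -/
def nlOrder (r : ℝ) : ℝ := max 0 (1 - r / 2)

theorem nlOrder_nonneg (r : ℝ) : 0 ≤ nlOrder r := le_max_left _ _

/-- `⟨ξ⟩^(-σ) iξ ŵ` in terms of `⟨ξ⟩^(r/2) ŵ`. -/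
def fluxSymbol (r η : ℝ) : ℂ := derivSymbol η * wt (-(nlOrder r + r / 2)) η

theorem bddSymbol_derivSymbol_mul_wt {s : ℝ} (hs : 1 ≤ s) :
    BddSymbol fun η => derivSymbol η * wt (-s) η := by
  refine .of_continuous_of_le (C := 1) (continuous_derivSymbol.mul
    (Complex.continuous_ofReal.comp (continuous_wt _))) fun η => ?_
  rw [norm_mul, norm_derivSymbol, Complex.norm_real, Real.norm_of_nonneg (wt_pos _ _).le]
  calc _ ≤ wt 1 η * wt (-s) η := mul_le_mul_of_nonneg_right (abs_le_wt_one η) (wt_pos _ _).le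
    _ = wt (1 + -s) η := (wt_add _ _ _).symm
    _ ≤ 1 := wt_le_one (by linarith) η

/-- This is w_x ∈ H^(r/2-1) ⊂ H^(-σ): the order σ = `nlOrder r` is chosen so that σ + r/2 ≥ 1. -/
theorem bddSymbol_fluxSymbol (r : ℝ) : BddSymbol (fluxSymbol r) := by
  apply bddSymbol_derivSymbol_mul_wt
  have : 1 - r / 2 ≤ nlOrder r := le_max_right _ _
  linarith

/-- The data of a solution on the Fourier side. -/
structure WeakSolution (l b : ℝ → ℝ) (ρ r p : ℝ) (T : EReal) (u w : ℝ → RealL2) : Prop where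
  adm : Admissible l b ρ r p
  cont_u : ContinuousInSobolev (s₀ ρ r) T u
  cont_w : ContinuousInSobolev (r / 2) T w
  eq_u : ∀ φ : 𝓢(ℝ, ℂ), ∀ t ∈ openTimes T,
    HasDerivAt (fun τ => pairing (u τ) φ) (-pairing (w t) (schwartzDeriv φ)) t
  eq_w : ∀ φ : 𝓢(ℝ, ℂ), ∀ t ∈ openTimes T,
    HasDerivAt (fun τ => pairing (w τ) φ)
      (-multiplierPairing l (toComplex (u t)) (schwartzDeriv φ)
        - multiplierPairing b (toComplex (powerNonlinearity p (u t))) (schwartzDeriv φ)) t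

theorem integrable_mul_of_hasCompactSupport {m : ℝ → ℂ} (hm : Continuous m) (f : ComplexL2)
    {ψ : 𝓢(ℝ, ℂ)} (hψ : HasCompactSupport ψ) : Integrable fun η => m η * f η * ψ η := by
  have := ((locallyIntegrable_coe f).continuous_mul hm).integrable_smul_left_of_hasCompactSupport
    ψ.continuous hψ
  simpa [smul_eq_mul, mul_comm] using this

namespace Admissible

variable (h : Admissible l b ρ r p)
include h

theorem nlOrder_le_one : nlOrder r ≤ 1 := max_le zero_le_one (by linarith [h.r_nonneg])

/-- The inequality 1 - r/2 ≤ s₀ is precisely the assumption 1 ≤ r + ρ/2; it lets g(u) inherit H^σ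
regularity from u. -/
theorem nlOrder_le : nlOrder r ≤ s₀ ρ r :=
  max_le h.s₀_nonneg (by have := h.one_le; rw [s₀]; linarith)

/-- Measuring w_t in H^(-1-ρ) makes Lu_x, and likewise B g(u)_x, depend continuously on u and g(u)
in L² alone. This crude weight is harmless, as it is undone at low frequencies only. -/
theorem bddSymbol_derivSymbol_l : BddSymbol fun η =>
    derivSymbol η * (l (2 * Real.pi * η) : ℂ) * wt (-(1 + ρ)) η := by
  obtain ⟨C, hC, hl⟩ := h.l_upper
  refine .of_continuous_of_le (C := C) ((continuous_derivSymbol.mul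
    (Complex.continuous_ofReal.comp (h.continuous_l.comp (by fun_prop)))).mul
    (Complex.continuous_ofReal.comp (continuous_wt _))) fun η => ?_
  rw [norm_mul, norm_mul, norm_derivSymbol, Complex.norm_real, Complex.norm_real,
    Real.norm_of_nonneg (wt_pos _ _).le, Real.norm_of_nonneg (h.l_pos η).le]
  calc _ ≤ wt 1 η * (C * wt ρ η) * wt (-(1 + ρ)) η := by
        refine mul_le_mul_of_nonneg_right ?_ (wt_pos _ _).le
        exact mul_le_mul (abs_le_wt_one η) (hl η) (h.l_pos η).le (wt_pos _ _).le
    _ = C * (wt (1 + ρ) η * wt (-(1 + ρ)) η) := by rw [wt_add]; ring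
    _ = C := by rw [wt_mul_neg, mul_one]

theorem bddSymbol_derivSymbol_b : BddSymbol fun η =>
    derivSymbol η * (b (2 * Real.pi * η) : ℂ) * wt (-(1 + ρ)) η := by
  obtain ⟨C, hC, hb⟩ := h.b_upper
  refine .of_continuous_of_le (C := C) ((continuous_derivSymbol.mul
    (Complex.continuous_ofReal.comp (h.continuous_b.comp (by fun_prop)))).mul
    (Complex.continuous_ofReal.comp (continuous_wt _))) fun η => ?_
  rw [norm_mul, norm_mul, norm_derivSymbol, Complex.norm_real, Complex.norm_real,
    Real.norm_of_nonneg (wt_pos _ _).le, Real.norm_of_nonneg (h.b_pos η).le]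
  calc _ ≤ wt 1 η * C * wt (-(1 + ρ)) η := by
        refine mul_le_mul_of_nonneg_right ?_ (wt_pos _ _).le
        refine mul_le_mul (abs_le_wt_one η) ((hb η).trans ?_) (h.b_pos η).le (wt_pos _ _).le
        exact mul_le_of_le_one_right hC.le (wt_le_one (by linarith [h.r_nonneg]) η)
    _ = C * wt (1 + -(1 + ρ)) η := by rw [wt_add]; ring
    _ ≤ C := mul_le_of_le_one_right hC.le (wt_le_one (by linarith [h.rho_nonneg]) η)

end Admissible

/-! ### Time regularity on the Fourier side and differentiation of Q -/

namespace WeakSolution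

variable (h : WeakSolution l b ρ r p T u w)
include h

theorem continuousOn_fourier_u :
    ContinuousOn (fun τ => (𝓕 (toComplex (u τ)) : ComplexL2)) (timeInterval T) := by
  refine ContinuousOn.congr ((mulOp _).continuous.comp_continuousOn h.cont_u.continuousOn_lift)
    fun τ hτ => (mulOp_wt_neg_lift h.adm.s₀_nonneg (h.cont_u.1 τ hτ)).symm

theorem continuousOn_u : ContinuousOn u (timeInterval T) := by
  intro t ht
  rw [ContinuousWithinAt, tendsto_iff_norm_sub_tendsto_zero]
  have h1 := h.continuousOn_fourier_u t ht
  rw [ContinuousWithinAt, tendsto_iff_norm_sub_tendsto_zero] at h1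
  refine h1.congr fun τ => ?_
  rw [← fourier_toComplex_sub, Lp.norm_fourier_eq, norm_toComplex]

/-- Local uniform bounds. -/
theorem exists_bound {t : ℝ} (ht : t ∈ timeInterval T) : ∃ R : ℝ, 0 < R ∧
    ∀ᶠ τ in 𝓝[timeInterval T] t, ‖lift (s₀ ρ r) (u τ)‖ ≤ R := by
  refine ⟨‖lift (s₀ ρ r) (u t)‖ + 1, by positivity, ?_⟩
  have := (h.cont_u.continuousOn_lift t ht).norm.eventually_lt_const
    (u := ‖lift (s₀ ρ r) (u t)‖ + 1) (by linarith)
  filter_upwards [this] with τ hτ using hτ.le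

theorem continuousOn_powerNonlinearity :
    ContinuousOn (fun τ => powerNonlinearity p (u τ)) (timeInterval T) := by
  intro t ht
  obtain ⟨R, hR, hb⟩ := h.exists_bound ht
  obtain ⟨C, hC, hsup⟩ := h.adm.exists_abs_le
  have hp := h.adm.one_lt_p
  rw [ContinuousWithinAt, tendsto_iff_norm_sub_tendsto_zero]
  have h1 := h.continuousOn_u t ht
  rw [ContinuousWithinAt, tendsto_iff_norm_sub_tendsto_zero] at h1
  have h2 := h1.const_mul (p * (C * R) ^ (p - 1))
  rw [mul_zero] at h2
  have hbd : ∀ τ ∈ timeInterval T, ‖lift (s₀ ρ r) (u τ)‖ ≤ R → ∀ᵐ x, |u τ x| ≤ C * R := by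
    intro τ hτ hle
    filter_upwards [hsup (u τ) (h.cont_u.1 τ hτ)] with x hx
    exact hx.trans (mul_le_mul_of_nonneg_left hle hC.le)
  refine squeeze_zero' (Eventually.of_forall fun _ => norm_nonneg _) ?_ h2
  filter_upwards [hb, self_mem_nhdsWithin] with τ h3 h4
  exact norm_powerNonlinearity_sub_le hp (hbd τ h4 h3)
    (hbd t ht (hb.self_of_nhdsWithin ht))

theorem ae_abs_le {τ : ℝ} (hτ : τ ∈ timeInterval T) : ∃ M : ℝ, 0 ≤ M ∧ ∀ᵐ x, |u τ x| ≤ M := by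
  obtain ⟨C, hC, hsup⟩ := h.adm.exists_abs_le
  exact ⟨_, by positivity, hsup (u τ) (h.cont_u.1 τ hτ)⟩

theorem continuousOn_nonlinearEnergy :
    ContinuousOn (fun τ => nonlinearEnergy p (u τ)) (timeInterval T) := by
  refine ContinuousOn.congr (h.continuousOn_powerNonlinearity.inner (𝕜 := ℝ) h.continuousOn_u).neg
    fun τ hτ => ?_
  obtain ⟨M, -, hM⟩ := h.ae_abs_le hτ
  exact nonlinearEnergy_eq_inner h.adm.one_lt_p hM

theorem continuousOn_fourier_powerNonlinearity :
    ContinuousOn (fun τ => (𝓕 (toComplex (powerNonlinearity p (u τ))) : ComplexL2))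
      (timeInterval T) := by
  refine (Lp.fourierTransformₗᵢ ℝ ℂ).continuous.comp_continuousOn ?_
  exact (Complex.ofRealCLM.compLpL 2 volume).continuous.comp_continuousOn
    h.continuousOn_powerNonlinearity

theorem powerNonlinearity_mem {τ : ℝ} (hτ : τ ∈ timeInterval T) :
    powerNonlinearity p (u τ) ∈ sobolev (nlOrder r) := by
  obtain ⟨M, hM0, hM⟩ := h.ae_abs_le hτ
  exact (powerNonlinearity_mem_sobolev h.adm.one_lt_p hM0 hM (nlOrder_nonneg r)
    h.adm.nlOrder_le_one (sobolev_mono h.adm.nlOrder_le (h.cont_u.1 τ hτ))).1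

/-- Boundedness of g(u) in H^σ is all that is needed: with continuity in L² it gives weak continuity
in H^σ. -/
theorem norm_lift_powerNonlinearity_le {R : ℝ} (hR : 0 ≤ R) : ∃ D : ℝ, 0 < D ∧
    ∀ τ ∈ timeInterval T, ‖lift (s₀ ρ r) (u τ)‖ ≤ R →
      ‖lift (nlOrder r) (powerNonlinearity p (u τ))‖ ≤ D := by
  obtain ⟨C, hC, hsup⟩ := h.adm.exists_abs_le
  have hp := h.adm.one_lt_p
  refine ⟨2 * (p * (C * R) ^ (p - 1)) * R + 1, by positivity, fun τ hτ hle => ?_⟩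
  have hM : ∀ᵐ x, |u τ x| ≤ C * R := by
    filter_upwards [hsup (u τ) (h.cont_u.1 τ hτ)] with x hx
    exact hx.trans (mul_le_mul_of_nonneg_left hle hC.le)
  have h1 := (powerNonlinearity_mem_sobolev hp (by positivity) hM (nlOrder_nonneg r)
    h.adm.nlOrder_le_one (sobolev_mono h.adm.nlOrder_le (h.cont_u.1 τ hτ))).2
  have h2 : ‖lift (nlOrder r) (u τ)‖ ≤ R := by
    rw [← mulOp_wt_lift h.adm.nlOrder_le (h.cont_u.1 τ hτ)]
    have h3 : nlOrder r - s₀ ρ r ≤ 0 := by linarith [h.adm.nlOrder_le]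
    refine (norm_mulOp_le (bddSymbol_wt h3) (C := 1) (fun x => ?_) _).trans ?_
    · rw [Complex.norm_real, Real.norm_of_nonneg (wt_pos _ _).le]
      exact wt_le_one h3 x
    · rwa [one_mul]
  have h3 : 0 ≤ 2 * (p * (C * R) ^ (p - 1)) := by positivity
  have := mul_le_mul_of_nonneg_left h2 h3
  linarith

/-- `⟨ξ⟩^(-σ) û` has the derivative `⟨ξ⟩^(-σ) iξ ŵ` in `L²`. -/
theorem hasDerivAt_u {t : ℝ} (ht : t ∈ openTimes T) :
    HasDerivAt (fun τ => mulOp (fun η => (wt (-nlOrder r) η : ℂ)) (𝓕 (toComplex (u τ))))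
      (mulOp (fluxSymbol r) (lift (r / 2) (w t))) t := by
  refine hasDerivAt_of_weak (M := wt (-nlOrder r)) (continuous_wt _) (wt_pos _)
    (Y := fun τ => mulOp (fluxSymbol r) (lift (r / 2) (w τ)))
    (U := fun τ => (𝓕 (toComplex (u τ)) : ComplexL2))
    (V := fun τ η => derivSymbol η * (𝓕 (toComplex (w τ)) : ComplexL2) η)
    (isOpen_openTimes T) (ordConnected_openTimes T) ?_ ?_ ?_ ?_ ht
  · exact (mulOp _).continuous.comp_continuousOn
      (h.cont_w.continuousOn_lift.mono (openTimes_subset T))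
  · intro τ _
    exact mulOp_ae (bddSymbol_wt (by linarith [(nlOrder_nonneg r)])) _
  · intro τ hτ
    filter_upwards [mulOp_ae (bddSymbol_fluxSymbol r) (lift (r / 2) (w τ)),
      lift_ae' (h.cont_w.1 τ (openTimes_subset T hτ))] with η h1 h2
    rw [h1, h2, fluxSymbol, neg_add, wt_add]
    push_cast
    ring
  · intro ψ _ τ hτ
    have := h.eq_u (𝓕 ψ) τ hτ
    simpa only [pairing_schwartzDeriv_fourier, pairing_fourier] using this

/-- `⟨ξ⟩^(-1-ρ) ŵ` is differentiable in `L²`. -/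
theorem hasDerivAt_w {t : ℝ} (ht : t ∈ openTimes T) :
    HasDerivAt (fun τ => mulOp (fun η => (wt (-(1 + ρ)) η : ℂ)) (𝓕 (toComplex (w τ))))
      (mulOp (fun η => derivSymbol η * (l (2 * Real.pi * η) : ℂ) * wt (-(1 + ρ)) η)
          (𝓕 (toComplex (u t)))
        + mulOp (fun η => derivSymbol η * (b (2 * Real.pi * η) : ℂ) * wt (-(1 + ρ)) η)
          (𝓕 (toComplex (powerNonlinearity p (u t))))) t := by
  have hρ := h.adm.rho_nonneg
  refine hasDerivAt_of_weak (M := wt (-(1 + ρ))) (continuous_wt _) (wt_pos _)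
    (Y := fun τ => mulOp (fun η => derivSymbol η * (l (2 * Real.pi * η) : ℂ) * wt (-(1 + ρ)) η)
          (𝓕 (toComplex (u τ)))
        + mulOp (fun η => derivSymbol η * (b (2 * Real.pi * η) : ℂ) * wt (-(1 + ρ)) η)
          (𝓕 (toComplex (powerNonlinearity p (u τ)))))
    (U := fun τ => (𝓕 (toComplex (w τ)) : ComplexL2))
    (V := fun τ η => derivSymbol η * (l (2 * Real.pi * η) : ℂ) * (𝓕 (toComplex (u τ)) : ComplexL2) η
      + derivSymbol η * (b (2 * Real.pi * η) : ℂ)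
        * (𝓕 (toComplex (powerNonlinearity p (u τ))) : ComplexL2) η)
    (isOpen_openTimes T) (ordConnected_openTimes T) ?_ ?_ ?_ ?_ ht
  · exact ((mulOp _).continuous.comp_continuousOn
      (h.continuousOn_fourier_u.mono (openTimes_subset T))).add ((mulOp _).continuous.comp_continuousOn
      (h.continuousOn_fourier_powerNonlinearity.mono (openTimes_subset T)))
  · intro τ _
    exact mulOp_ae (bddSymbol_wt (by linarith)) _
  · intro τ _
    filter_upwards [mulOp_ae h.adm.bddSymbol_derivSymbol_l (𝓕 (toComplex (u τ))),
      mulOp_ae h.adm.bddSymbol_derivSymbol_b (𝓕 (toComplex (powerNonlinearity p (u τ)))),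
      Lp.coeFn_add
        (mulOp (fun η => derivSymbol η * (l (2 * Real.pi * η) : ℂ) * wt (-(1 + ρ)) η)
          (𝓕 (toComplex (u τ))))
        (mulOp (fun η => derivSymbol η * (b (2 * Real.pi * η) : ℂ) * wt (-(1 + ρ)) η)
          (𝓕 (toComplex (powerNonlinearity p (u τ)))))] with η h1 h2 h3
    rw [h3, Pi.add_apply, h1, h2]
    ring
  · intro ψ hψ τ hτ
    have h1 := h.eq_w (𝓕 ψ) τ hτ
    rw [sub_eq_add_neg] at h1
    simp only [multiplierPairing_schwartzDeriv_fourier, pairing_fourier] at h1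
    rw [← integral_add] at h1
    · simpa only [add_mul] using h1
    · exact integrable_mul_of_hasCompactSupport (continuous_derivSymbol.mul
        (Complex.continuous_ofReal.comp (h.adm.continuous_l.comp (by fun_prop)))) _ hψ
    · exact integrable_mul_of_hasCompactSupport (continuous_derivSymbol.mul
        (Complex.continuous_ofReal.comp (h.adm.continuous_b.comp (by fun_prop)))) _ hψ

/-- The weights of orders σ and -σ cancel, and Plancherel turns the duality pairing into the L²
product. -/
theorem inner_powerNonlinearity_sub {τ τ₁ τ₂ : ℝ} (hτ : τ ∈ timeInterval T) :
    (inner ℂ (-lift (nlOrder r) (powerNonlinearity p (u τ)))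
      (mulOp (fun η => (wt (-nlOrder r) η : ℂ)) (𝓕 (toComplex (u τ₁)))
        - mulOp (fun η => (wt (-nlOrder r) η : ℂ)) (𝓕 (toComplex (u τ₂))))).re
      = -inner ℝ (powerNonlinearity p (u τ)) (u τ₁ - u τ₂) := by
  have hb : BddSymbol fun η => (wt (-nlOrder r) η : ℂ) :=
    bddSymbol_wt (by linarith [(nlOrder_nonneg r)])
  have h1 := inner_mulOp_left hb (lift (nlOrder r) (powerNonlinearity p (u τ)))
    (𝓕 (toComplex (u τ₁ - u τ₂)))
  simp only [Complex.conj_ofReal] at h1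
  rw [mulOp_wt_neg_lift (nlOrder_nonneg r) (h.powerNonlinearity_mem hτ), Lp.inner_fourier_eq,
    inner_toComplex, fourier_toComplex_sub, map_sub] at h1
  rw [inner_neg_left, ← h1, Complex.neg_re, Complex.ofReal_re]

/-- The convex chain rule `hasDerivAt_of_inner_le_of_le_inner`, with u viewed as a differentiable
curve in H^(-σ) and the gradient -g(u) in the dual space H^σ. -/
theorem hasDerivAt_nonlinearEnergy {t : ℝ} (ht : t ∈ openTimes T) :
    HasDerivAt (fun τ => 1 / (p + 1) * nonlinearEnergy p (u τ))
      (inner ℂ (-lift (nlOrder r) (powerNonlinearity p (u t)))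
        (mulOp (fluxSymbol r) (lift (r / 2) (w t)))).re t := by
  have ht' := openTimes_subset T ht
  have hnhds : 𝓝[timeInterval T] t = 𝓝 t := nhdsWithin_eq_nhds.2
    (mem_of_superset ((isOpen_openTimes T).mem_nhds ht) (openTimes_subset T))
  have hmem : ∀ᶠ τ in 𝓝 t, τ ∈ timeInterval T :=
    mem_of_superset ((isOpen_openTimes T).mem_nhds ht) (openTimes_subset T)
  obtain ⟨R, hR, hb⟩ := h.exists_bound ht'
  rw [hnhds] at hb
  obtain ⟨D, hD, hbd⟩ := h.norm_lift_powerNonlinearity_le hR.le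
  have hp := h.adm.one_lt_p
  have hbdd : ∀ᶠ τ in 𝓝 t, ‖-lift (nlOrder r) (powerNonlinearity p (u τ))‖ ≤ D := by
    filter_upwards [hb, hmem] with τ h1 h2
    rw [norm_neg]
    exact hbd τ h2 h1
  have hwtb : BddSymbol fun η => (wt (-nlOrder r) η : ℂ) :=
    bddSymbol_wt (by linarith [(nlOrder_nonneg r)])
  have conv : ∀ τ ∈ timeInterval T, ∀ τ' ∈ timeInterval T,
      -inner ℝ (powerNonlinearity p (u τ)) (u τ' - u τ)
        ≤ 1 / (p + 1) * (nonlinearEnergy p (u τ') - nonlinearEnergy p (u τ)) := by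
    intro τ hτ τ' hτ'
    obtain ⟨M, -, hM⟩ := h.ae_abs_le hτ
    obtain ⟨M', -, hM'⟩ := h.ae_abs_le hτ'
    refine inner_le_nonlinearEnergy_sub (M := max M M') hp ?_ ?_
    · filter_upwards [hM] with x hx using hx.trans (le_max_left _ _)
    · filter_upwards [hM'] with x hx using hx.trans (le_max_right _ _)
  refine hasDerivAt_of_inner_le_of_le_inner
    (a := fun τ => -lift (nlOrder r) (powerNonlinearity p (u τ))) (h.hasDerivAt_u ht) hbdd ?_ ?_ ?_
  · refine (Complex.continuous_re.tendsto _).comp ?_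
    -- Weak continuity of g(u) in H^σ: against band-limited vectors the weight moves to the other
    -- factor, leaving the L² continuity of g(u).
    refine tendsto_inner_of_bounded hbdd (tendsto_mulOp_cut _) fun N => ?_
    set Z := mulOp (fluxSymbol r) (lift (r / 2) (w t))
    have hc : BddSymbol fun η => cut N η * (wt (nlOrder r) η : ℂ) :=
      bddSymbol_cut_mul N (Complex.continuous_ofReal.comp (continuous_wt (nlOrder r)))
    have e1 : mulOp (cut N) Z = mulOp (fun η => (wt (-nlOrder r) η : ℂ))
        (mulOp (fun η => cut N η * (wt (nlOrder r) η : ℂ)) Z) := by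
      rw [mulOp_mulOp hwtb hc]
      congr 2
      ext η
      rw [mul_left_comm, ← Complex.ofReal_mul, wt_neg_mul, Complex.ofReal_one, mul_one]
    have e2 : ∀ τ ∈ timeInterval T,
        inner ℂ (-lift (nlOrder r) (powerNonlinearity p (u τ))) (mulOp (cut N) Z)
          = -inner ℂ (𝓕 (toComplex (powerNonlinearity p (u τ))) : ComplexL2)
            (mulOp (fun η => cut N η * (wt (nlOrder r) η : ℂ)) Z) := by
      intro τ hτ
      rw [e1, inner_neg_left,
        ← mulOp_wt_neg_lift (nlOrder_nonneg r) (h.powerNonlinearity_mem hτ),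
        inner_mulOp_left hwtb]
      simp only [Complex.conj_ofReal]
    rw [e2 t ht']
    have h3 := h.continuousOn_fourier_powerNonlinearity t ht'
    rw [ContinuousWithinAt, hnhds] at h3
    refine ((h3.inner (tendsto_const_nhds (x := mulOp (fun η => cut N η *
      (wt (nlOrder r) η : ℂ)) Z))).neg).congr' ?_
    filter_upwards [hmem] with τ hτ
    rw [e2 τ hτ]
  · filter_upwards [hmem] with τ hτ
    rw [h.inner_powerNonlinearity_sub ht', ← mul_sub]
    exact conv t ht' τ hτ
  · filter_upwards [hmem] with τ hτ
    rw [h.inner_powerNonlinearity_sub hτ, ← mul_sub]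
    have := conv τ hτ t ht'
    rw [← neg_sub (u τ), inner_neg_right] at this
    linarith

end WeakSolution

/-! ### The quadratic energy at low frequencies -/

theorem hasDerivAt_half_norm_sq {P : ℝ → ComplexL2} {P' : ComplexL2} {t : ℝ}
    (hP : HasDerivAt P P' t) :
    HasDerivAt (fun τ => 1 / 2 * ‖P τ‖ ^ 2) (inner ℂ (P t) P').re t := by
  have h1 := (Complex.reCLM.hasFDerivAt.comp_hasDerivAt t (hP.inner ℂ hP)).const_mul (1 / 2 : ℝ)
  have h2 : (inner ℂ P' (P t)).re = (inner ℂ (P t) P').re := by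
    rw [← inner_conj_symm, Complex.conj_re]
  have h3 : 1 / 2 * Complex.reCLM (inner ℂ (P t) P' + inner ℂ P' (P t)) = (inner ℂ (P t) P').re := by
    rw [Complex.reCLM_apply, Complex.add_re, h2]
    ring
  rw [h3] at h1
  refine h1.congr_of_eventuallyEq (Eventually.of_forall fun τ => ?_)
  simp only [Function.comp, Complex.reCLM_apply]
  rw [inner_self_eq_norm_sq_to_K]
  congr 1
  norm_cast

/-- The cancellation behind the conservation of energy at a single frequency. -/
theorem energy_cancellation {c : ℂ} (hc : c = 0 ∨ c = 1) (ξ β κ s bb x : ℝ) (hβ : β ^ 2 * bb = 1)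
    (hs : s * x = 1) (U W G : ℂ) :
    ((c * (β * (2 * Real.pi * ξ * Complex.I * (κ ^ 2 : ℝ) * U + 2 * Real.pi * ξ * Complex.I * bb * G)))
        * (starRingEnd ℂ) (c * (β * W))).re
      + ((c * (β * κ * (2 * Real.pi * ξ * Complex.I * W)))
        * (starRingEnd ℂ) (c * (β * κ * U))).re
      + ((x * G) * (starRingEnd ℂ) (c * (2 * Real.pi * ξ * Complex.I * (s * W)))).re = 0 := by
  rcases hc with rfl | rfl
  · simp
  · simp only [Complex.mul_re, Complex.mul_im, Complex.add_re, Complex.add_im, Complex.conj_re,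
      Complex.conj_im, Complex.ofReal_re, Complex.ofReal_im, Complex.I_re, Complex.I_im,
      Complex.one_re, Complex.one_im, Complex.re_ofNat, Complex.im_ofNat]
    linear_combination (2 * Real.pi * ξ * (G.re * W.im - G.im * W.re)) * hβ
      - (2 * Real.pi * ξ * (G.re * W.im - G.im * W.re)) * hs

theorem cut_eq (N : ℕ) (η : ℝ) : cut N η = 0 ∨ cut N η = 1 := by
  unfold cut; split_ifs <;> simp

namespace WeakSolution

variable (h : WeakSolution l b ρ r p T u w)
include h

/-- The derivative of the quadratic part of the energy, restricted to low frequencies. -/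
theorem hasDerivAt_truncated (N : ℕ) {t : ℝ} (ht : t ∈ openTimes T) :
    HasDerivAt (fun τ =>
        1 / 2 * ‖mulOp (cut N) (mulOp (kineticSymbol b r) (lift (r / 2) (w τ)))‖ ^ 2
        + 1 / 2 * ‖mulOp (cut N) (mulOp (dispersiveSymbol l b ρ r) (lift (s₀ ρ r) (u τ)))‖ ^ 2)
      (-inner ℂ (mulOp (cut N) (mulOp (fluxSymbol r) (lift (r / 2) (w t))))
        (lift (nlOrder r) (powerNonlinearity p (u t)))).re t := by
  have hρ := h.adm.rho_nonneg
  have ht' := openTimes_subset T ht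
  have hcut := bddSymbol_cut N
  -- The cutoff makes bounded the symbols that undo the negative weights under which w and u are
  -- differentiable.
  have hm1 : BddSymbol fun η => cut N η * ((bInvSqrt b η * wt (1 + ρ) η : ℝ) : ℂ) :=
    bddSymbol_cut_mul N (Complex.continuous_ofReal.comp
      (h.adm.continuous_bInvSqrt.mul (continuous_wt _)))
  have hm2 : BddSymbol fun η => cut N η * ((bInvSqrt b η * lSqrt l η * wt (nlOrder r) η : ℝ) : ℂ) :=
    bddSymbol_cut_mul N (Complex.continuous_ofReal.comp
      ((h.adm.continuous_bInvSqrt.mul h.adm.continuous_lSqrt).mul (continuous_wt _)))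
  have hwtσ : BddSymbol fun η => (wt (-nlOrder r) η : ℂ) :=
    bddSymbol_wt (by linarith [nlOrder_nonneg r])
  have hwtρ : BddSymbol fun η => (wt (-(1 + ρ)) η : ℂ) := bddSymbol_wt (by linarith)
  have hP0 : ∀ τ ∈ timeInterval T,
      mulOp (cut N) (mulOp (kineticSymbol b r) (lift (r / 2) (w τ))) =ᵐ[volume]
        fun η => cut N η * (bInvSqrt b η * (𝓕 (toComplex (w τ)) : ComplexL2) η) := by
    intro τ hτ
    filter_upwards [mulOp_ae hcut (mulOp (kineticSymbol b r) (lift (r / 2) (w τ))),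
      mulOp_ae h.adm.bddSymbol_kineticSymbol (lift (r / 2) (w τ)), lift_ae' (h.cont_w.1 τ hτ)]
      with η h1 h2 h3
    rw [h1, h2, h3, kineticSymbol]
    push_cast
    ring
  have hR0 : ∀ τ ∈ timeInterval T,
      mulOp (cut N) (mulOp (dispersiveSymbol l b ρ r) (lift (s₀ ρ r) (u τ))) =ᵐ[volume]
        fun η => cut N η * (bInvSqrt b η * lSqrt l η * (𝓕 (toComplex (u τ)) : ComplexL2) η) := by
    intro τ hτ
    filter_upwards [mulOp_ae hcut (mulOp (dispersiveSymbol l b ρ r) (lift (s₀ ρ r) (u τ))),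
      mulOp_ae h.adm.bddSymbol_dispersiveSymbol (lift (s₀ ρ r) (u τ)),
      lift_ae' (h.cont_u.1 τ hτ)] with η h1 h2 h3
    rw [h1, h2, h3, dispersiveSymbol]
    push_cast
    ring
  have hnhds : ∀ᶠ τ in 𝓝 t, τ ∈ timeInterval T :=
    mem_of_superset ((isOpen_openTimes T).mem_nhds ht) (openTimes_subset T)
  have hP : HasDerivAt (fun τ => mulOp (cut N) (mulOp (kineticSymbol b r) (lift (r / 2) (w τ))))
      (mulOp (fun η => cut N η * ((bInvSqrt b η * wt (1 + ρ) η : ℝ) : ℂ))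
        (mulOp (fun η => derivSymbol η * (l (2 * Real.pi * η) : ℂ) * wt (-(1 + ρ)) η)
          (𝓕 (toComplex (u t)))
        + mulOp (fun η => derivSymbol η * (b (2 * Real.pi * η) : ℂ) * wt (-(1 + ρ)) η)
          (𝓕 (toComplex (powerNonlinearity p (u t)))))) t := by
    refine (((mulOp (fun η => cut N η * ((bInvSqrt b η * wt (1 + ρ) η : ℝ) : ℂ))).restrictScalars
      ℝ).hasFDerivAt.comp_hasDerivAt t (h.hasDerivAt_w ht)).congr_of_eventuallyEq ?_
    filter_upwards [hnhds] with τ hτ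
    refine (mulOp_eq_of_ae hm1 ?_).symm
    filter_upwards [hP0 τ hτ, mulOp_ae hwtρ (𝓕 (toComplex (w τ)))] with η h1 h2
    rw [h1, h2]
    have := congrArg (fun y : ℝ => (y : ℂ)) (wt_mul_neg (1 + ρ) η)
    push_cast at this ⊢
    linear_combination (-(cut N η * bInvSqrt b η * (𝓕 (toComplex (w τ)) : ComplexL2) η)) * this
  have hR : HasDerivAt
      (fun τ => mulOp (cut N) (mulOp (dispersiveSymbol l b ρ r) (lift (s₀ ρ r) (u τ))))
      (mulOp (fun η => cut N η * ((bInvSqrt b η * lSqrt l η * wt (nlOrder r) η : ℝ) : ℂ))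
        (mulOp (fluxSymbol r) (lift (r / 2) (w t)))) t := by
    refine (((mulOp (fun η => cut N η * ((bInvSqrt b η * lSqrt l η * wt (nlOrder r) η : ℝ) :
      ℂ))).restrictScalars ℝ).hasFDerivAt.comp_hasDerivAt t
      (h.hasDerivAt_u ht)).congr_of_eventuallyEq ?_
    filter_upwards [hnhds] with τ hτ
    refine (mulOp_eq_of_ae hm2 ?_).symm
    filter_upwards [hR0 τ hτ, mulOp_ae hwtσ (𝓕 (toComplex (u τ)))] with η h1 h2
    rw [h1, h2]
    have := congrArg (fun y : ℝ => (y : ℂ)) (wt_mul_neg (nlOrder r) η)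
    push_cast at this ⊢
    linear_combination
      (-(cut N η * bInvSqrt b η * lSqrt l η * (𝓕 (toComplex (u τ)) : ComplexL2) η)) * this
  refine ((hasDerivAt_half_norm_sq hP).add (hasDerivAt_half_norm_sq hR)).congr_deriv ?_
  rw [Complex.neg_re, ← add_eq_zero_iff_eq_neg]
  rw [← Complex.add_re, ← Complex.add_re, L2.inner_def, L2.inner_def, L2.inner_def,
    ← integral_add (L2.integrable_inner _ _) (L2.integrable_inner _ _),
    ← integral_add ((L2.integrable_inner _ _).add (L2.integrable_inner _ _))
      (L2.integrable_inner _ _)]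
  -- All three pairings are integrals over the same frequency variable, so it suffices that the real
  -- part of the combined integrand vanishes pointwise, which is `energy_cancellation`.
  have hre := integral_re (𝕜 := ℂ) (((L2.integrable_inner (𝕜 := ℂ)
    (mulOp (cut N) (mulOp (kineticSymbol b r) (lift (r / 2) (w t))))
    (mulOp (fun η => cut N η * ((bInvSqrt b η * wt (1 + ρ) η : ℝ) : ℂ))
      (mulOp (fun η => derivSymbol η * (l (2 * Real.pi * η) : ℂ) * wt (-(1 + ρ)) η)
          (𝓕 (toComplex (u t)))
        + mulOp (fun η => derivSymbol η * (b (2 * Real.pi * η) : ℂ) * wt (-(1 + ρ)) η)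
          (𝓕 (toComplex (powerNonlinearity p (u t))))))).add (L2.integrable_inner (𝕜 := ℂ)
    (mulOp (cut N) (mulOp (dispersiveSymbol l b ρ r) (lift (s₀ ρ r) (u t))))
    (mulOp (fun η => cut N η * ((bInvSqrt b η * lSqrt l η * wt (nlOrder r) η : ℝ) : ℂ))
      (mulOp (fluxSymbol r) (lift (r / 2) (w t)))))).add (L2.integrable_inner (𝕜 := ℂ)
    (mulOp (cut N) (mulOp (fluxSymbol r) (lift (r / 2) (w t))))
    (lift (nlOrder r) (powerNonlinearity p (u t)))))
  refine hre.symm.trans ?_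
  rw [← integral_zero ℝ ℝ]
  apply integral_congr_ae
  filter_upwards [hP0 t ht', hR0 t ht',
    mulOp_ae hm1 (mulOp (fun η => derivSymbol η * (l (2 * Real.pi * η) : ℂ) * wt (-(1 + ρ)) η)
          (𝓕 (toComplex (u t)))
        + mulOp (fun η => derivSymbol η * (b (2 * Real.pi * η) : ℂ) * wt (-(1 + ρ)) η)
          (𝓕 (toComplex (powerNonlinearity p (u t))))),
    Lp.coeFn_add (mulOp (fun η => derivSymbol η * (l (2 * Real.pi * η) : ℂ) * wt (-(1 + ρ)) η)
          (𝓕 (toComplex (u t))))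
        (mulOp (fun η => derivSymbol η * (b (2 * Real.pi * η) : ℂ) * wt (-(1 + ρ)) η)
          (𝓕 (toComplex (powerNonlinearity p (u t))))),
    mulOp_ae h.adm.bddSymbol_derivSymbol_l (𝓕 (toComplex (u t))),
    mulOp_ae h.adm.bddSymbol_derivSymbol_b (𝓕 (toComplex (powerNonlinearity p (u t)))),
    mulOp_ae hm2 (mulOp (fluxSymbol r) (lift (r / 2) (w t))),
    mulOp_ae (bddSymbol_fluxSymbol r) (lift (r / 2) (w t)),
    mulOp_ae hcut (mulOp (fluxSymbol r) (lift (r / 2) (w t))),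
    lift_ae' (h.cont_w.1 t ht'), lift_ae (h.powerNonlinearity_mem ht')]
    with η e1 e2 e3 e4 e5 e6 e7 e8 e9 e10 e11
  simp only [Pi.add_apply, RCLike.inner_apply]
  rw [e1, e2, e3, e4, Pi.add_apply, e5, e6, e7, e9, e8, e11]
  have hflux : fluxSymbol r η * lift (r / 2) (w t) η
      = derivSymbol η * (wt (-nlOrder r) η * (𝓕 (toComplex (w t)) : ComplexL2) η) := by
    rw [e10, fluxSymbol, neg_add, wt_add]
    push_cast
    ring
  rw [hflux]
  have key := energy_cancellation (cut_eq N η) η (bInvSqrt b η) (lSqrt l η) (wt (-nlOrder r) η)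
    (b (2 * Real.pi * η)) (wt (nlOrder r) η) (h.adm.bInvSqrt_sq η) (wt_neg_mul _ _)
    ((𝓕 (toComplex (u t)) : ComplexL2) η) ((𝓕 (toComplex (w t)) : ComplexL2) η)
    ((𝓕 (toComplex (powerNonlinearity p (u t))) : ComplexL2) η)
  rw [h.adm.lSqrt_sq] at key
  rw [RCLike.re_eq_complex_re]
  rw [← key, Complex.add_re, Complex.add_re]
  have w1 : ((wt (1 + ρ) η : ℝ) : ℂ) * (wt (-(1 + ρ)) η : ℝ) = 1 := by
    rw [← Complex.ofReal_mul, wt_mul_neg, Complex.ofReal_one]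
  have w2 : ((wt (nlOrder r) η : ℝ) : ℂ) * (wt (-nlOrder r) η : ℝ) = 1 := by
    rw [← Complex.ofReal_mul, wt_mul_neg, Complex.ofReal_one]
  congr 3
  · congr 1
    rw [derivSymbol]
    push_cast
    linear_combination (cut N η * bInvSqrt b η * (2 * Real.pi * η * Complex.I)
      * (l (2 * Real.pi * η) * (𝓕 (toComplex (u t)) : ComplexL2) η + b (2 * Real.pi * η)
      * (𝓕 (toComplex (powerNonlinearity p (u t))) : ComplexL2) η)) * w1
  · congr 1
    rw [derivSymbol]
    push_cast
    linear_combination (cut N η * bInvSqrt b η * lSqrt l η * (2 * Real.pi * η * Complex.I)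
      * (𝓕 (toComplex (w t)) : ComplexL2) η) * w2

end WeakSolution

/-! ### Conservation of the energy and the sign of 2I - Q -/

namespace WeakSolution

variable (h : WeakSolution l b ρ r p T u w)
include h

theorem continuousOn_dispersiveEnergy :
    ContinuousOn (fun τ => dispersiveEnergy l b (u τ)) (timeInterval T) := by
  refine ContinuousOn.congr (continuousOn_const.mul ((((mulOp _).continuous.comp_continuousOn
    h.cont_u.continuousOn_lift).norm).pow 2)) fun τ hτ => h.adm.dispersiveEnergy_eq (h.cont_u.1 τ hτ)

theorem continuousOn_energy :
    ContinuousOn (fun τ => energy l b p (u τ) (w τ)) (timeInterval T) := by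
  refine ContinuousOn.congr (((continuousOn_const.mul ((((mulOp _).continuous.comp_continuousOn
    h.cont_w.continuousOn_lift).norm).pow 2)).add (continuousOn_const.mul
    ((((mulOp _).continuous.comp_continuousOn h.cont_u.continuousOn_lift).norm).pow 2))).sub
    (continuousOn_const.mul h.continuousOn_nonlinearEnergy))
    fun τ hτ => h.adm.energy_eq (h.cont_u.1 τ hτ) (h.cont_w.1 τ hτ)

/-- The energy with truncated quadratic part but full Q has as derivative the pairing of g(u) with
the high frequencies of w_x. The first factor is bounded in H^σ between the two times, and the
second is uniformly small since w_x traces a compact set in H^(-σ); the mean value inequality and N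
→ ∞ conclude. -/
theorem energy_eq_of_mem_openTimes {t₁ t₂ : ℝ} (h₁ : t₁ ∈ openTimes T) (h₂ : t₂ ∈ openTimes T) :
    energy l b p (u t₂) (w t₂) = energy l b p (u t₁) (w t₁) := by
  have hsub : Set.uIcc t₁ t₂ ⊆ openTimes T := (ordConnected_openTimes T).uIcc_subset h₁ h₂
  have hsub' := hsub.trans (openTimes_subset T)
  set Z : ℝ → ComplexL2 := fun τ => mulOp (fluxSymbol r) (lift (r / 2) (w τ)) with hZ
  set D : ℕ → ℝ → ℝ := fun N τ =>
    (1 / 2 * ‖mulOp (cut N) (mulOp (kineticSymbol b r) (lift (r / 2) (w τ)))‖ ^ 2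
      + 1 / 2 * ‖mulOp (cut N) (mulOp (dispersiveSymbol l b ρ r) (lift (s₀ ρ r) (u τ)))‖ ^ 2)
      - 1 / (p + 1) * nonlinearEnergy p (u τ) with hD
  have hder : ∀ N, ∀ τ ∈ openTimes T, HasDerivAt (D N)
      (inner ℂ (mulOp (fun η => 1 - cut N η) (Z τ))
        (lift (nlOrder r) (powerNonlinearity p (u τ)))).re τ := by
    intro N τ hτ
    refine ((h.hasDerivAt_truncated N hτ).sub (h.hasDerivAt_nonlinearEnergy hτ)).congr_deriv ?_
    have e : (inner ℂ (lift (nlOrder r) (powerNonlinearity p (u τ))) (Z τ)).re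
        = (inner ℂ (Z τ) (lift (nlOrder r) (powerNonlinearity p (u τ)))).re := by
      rw [← inner_conj_symm, Complex.conj_re]
    rw [mulOp_one_sub_cut, inner_sub_left, inner_neg_left, Complex.neg_re, Complex.neg_re,
      Complex.sub_re, e]
    ring
  have hlim : ∀ τ ∈ timeInterval T,
      Tendsto (fun N => D N τ) atTop (𝓝 (energy l b p (u τ) (w τ))) := by
    intro τ hτ
    rw [h.adm.energy_eq (h.cont_u.1 τ hτ) (h.cont_w.1 τ hτ)]
    exact ((((tendsto_mulOp_cut _).norm.pow 2).const_mul _).add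
      (((tendsto_mulOp_cut _).norm.pow 2).const_mul _)).sub_const _
  obtain ⟨R, hR⟩ := isCompact_uIcc.exists_bound_of_continuousOn
    (h.cont_u.continuousOn_lift.mono hsub')
  obtain ⟨M, hM, hS⟩ := h.norm_lift_powerNonlinearity_le (abs_nonneg R)
  have hZc : IsCompact (Z '' Set.uIcc t₁ t₂) := isCompact_uIcc.image_of_continuousOn
    ((mulOp _).continuous.comp_continuousOn (h.cont_w.continuousOn_lift.mono hsub'))
  have hε : ∀ ε : ℝ, 0 < ε → |energy l b p (u t₂) (w t₂) - energy l b p (u t₁) (w t₁)|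
      ≤ ε * M * |t₂ - t₁| := by
    intro ε hε
    refine le_of_tendsto (((hlim t₂ (openTimes_subset T h₂)).sub
      (hlim t₁ (openTimes_subset T h₁))).abs) ?_
    filter_upwards [eventually_forall_norm_le_of_isCompact norm_mulOp_one_sub_cut_le
      tendsto_mulOp_one_sub_cut hZc hε] with N hN
    refine (convex_uIcc t₁ t₂).norm_image_sub_le_of_norm_hasDerivWithin_le
      (fun τ hτ => (hder N τ (hsub hτ)).hasDerivWithinAt) (fun τ hτ => ?_)
      Set.left_mem_uIcc Set.right_mem_uIcc
    refine (Complex.abs_re_le_norm _).trans ((norm_inner_le_norm _ _).trans ?_)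
    exact mul_le_mul (hN _ (Set.mem_image_of_mem Z hτ))
      (hS τ (hsub' hτ) ((hR τ hτ).trans (le_abs_self R))) (norm_nonneg _) hε.le
  have hlim0 : Tendsto (fun ε : ℝ => ε * M * |t₂ - t₁|) (𝓝[>] 0) (𝓝 0) := by
    have : Continuous fun ε : ℝ => ε * M * |t₂ - t₁| := by fun_prop
    simpa using this.continuousWithinAt (s := Set.Ioi 0) (x := 0) |>.tendsto
  have := ge_of_tendsto hlim0 (eventually_nhdsWithin_of_forall hε)
  exact sub_eq_zero.1 (abs_nonpos_iff.1 this)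

/-- Conservation of energy. -/
theorem energy_conservation {t : ℝ} (ht : t ∈ openTimes T) :
    energy l b p (u t) (w t) = energy l b p (u 0) (w 0) := by
  have h0 : (0 : ℝ) ∈ timeInterval T :=
    ⟨le_rfl, (EReal.coe_lt_coe_iff.2 ht.1).trans ht.2⟩
  have hsub : Set.Ioo 0 t ⊆ openTimes T := fun τ hτ =>
    ⟨hτ.1, (EReal.coe_lt_coe_iff.2 hτ.2).trans ht.2⟩
  -- The equations hold only for positive times, so time 0 is reached by continuity.
  have h1 : Tendsto (fun τ => energy l b p (u τ) (w τ)) (𝓝[>] 0)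
      (𝓝 (energy l b p (u 0) (w 0))) := by
    rw [← nhdsWithin_Ioo_eq_nhdsGT ht.1]
    exact (h.continuousOn_energy 0 h0).mono (hsub.trans (openTimes_subset T))
  refine tendsto_nhds_unique (tendsto_const_nhds.congr' ?_) h1
  filter_upwards [Ioo_mem_nhdsGT ht.1] with τ hτ
  exact h.energy_eq_of_mem_openTimes (hsub hτ) ht

/-- The functional `2 I(u) - Q(u)` does not change sign below the critical energy level. -/
theorem nehari_nonneg_iff (hd : energy l b p (u 0) (w 0) < criticalEnergy l b ρ r p) {t : ℝ}
    (ht : t ∈ openTimes T) :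
    0 ≤ 2 * dispersiveEnergy l b (u 0) - nonlinearEnergy p (u 0) ↔
      0 ≤ 2 * dispersiveEnergy l b (u t) - nonlinearEnergy p (u t) := by
  set P : ℝ → ℝ := fun τ => 2 * dispersiveEnergy l b (u τ) - nonlinearEnergy p (u τ) with hP
  have hsub : Set.Icc 0 t ⊆ timeInterval T := fun τ hτ =>
    ⟨hτ.1, (EReal.coe_le_coe_iff.2 hτ.2).trans_lt ht.2⟩
  have hPc : ContinuousOn P (timeInterval T) :=
    (continuousOn_const.mul h.continuousOn_dispersiveEnergy).sub h.continuousOn_nonlinearEnergy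
  have hE : ∀ τ ∈ timeInterval T, energy l b p (u τ) (w τ) < criticalEnergy l b ρ r p := by
    intro τ hτ
    rcases hτ.1.eq_or_lt with h0 | h0
    · rwa [← h0]
    · rwa [h.energy_conservation ⟨h0, hτ.2⟩]
  -- A real `sInf` bounds its set from below only if some lower bound exists. On the constraint Q =
  -- 2I the energy is at least (1 - 2/(p+1)) I ≥ 0.
  have hbdd : BddBelow {e : ℝ | ∃ u w : RealL2, (u, w) ∈ energySpace ρ r ∧ u ≠ 0 ∧
      2 * dispersiveEnergy l b u - nonlinearEnergy p u = 0 ∧ e = energy l b p u w} := by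
    refine ⟨0, ?_⟩
    rintro e ⟨u, w, -, -, h1, rfl⟩
    have hp := h.adm.one_lt_p
    have h2 : 0 ≤ dispersiveEnergy l b u := by unfold dispersiveEnergy; positivity
    have h3 : energy l b p u w = 1 / 2 * ‖invSqrtB b (toComplex w)‖ ^ 2
        + dispersiveEnergy l b u - 1 / (p + 1) * nonlinearEnergy p u := rfl
    have h4 : 1 / (p + 1) ≤ 1 / 2 := by
      apply one_div_le_one_div_of_le <;> linarith
    have h5 : nonlinearEnergy p u = 2 * dispersiveEnergy l b u := by linarith
    rw [h3, h5]
    nlinarith [sq_nonneg ‖invSqrtB b (toComplex w)‖]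
  have hzero : ∀ τ ∈ timeInterval T, P τ = 0 → u τ = 0 := by
    intro τ hτ h0
    by_contra hne
    refine absurd (hE τ hτ) (not_lt.2 (csInf_le hbdd ⟨u τ, w τ, ⟨h.cont_u.1 τ hτ, ?_⟩, hne, h0, rfl⟩))
    have := h.cont_w.1 τ hτ
    rwa [show r / 2 = s₀ ρ r - ρ / 2 by rw [s₀]; ring] at this
  obtain ⟨δ, hδ, hnear⟩ := h.adm.exists_nonlinearEnergy_le
  -- The delicate case is P = 0: then u = 0, and P ≥ 0 throughout an H^s₀ ball around 0.
  have hopen : ∀ τ ∈ timeInterval T, 0 ≤ P τ → ∀ᶠ τ' in 𝓝[timeInterval T] τ, 0 ≤ P τ' := by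
    intro τ hτ h0
    rcases h0.eq_or_lt with h1 | h1
    · have hu0 : lift (s₀ ρ r) (u τ) = 0 := by
        rw [hzero τ hτ h1.symm]
        exact (zero_mem_sobolev _).2
      have hc := (h.cont_u.continuousOn_lift τ hτ).norm
      rw [ContinuousWithinAt, hu0, norm_zero] at hc
      filter_upwards [hc.eventually_lt_const hδ, self_mem_nhdsWithin] with τ' h2 h3
      exact hnear _ (h.cont_u.1 τ' h3) h2
    · filter_upwards [(hPc τ hτ).eventually_const_lt h1] with τ' h2 using h2.le
  -- Openness of both {P ≥ 0} and {P < 0} is continuity of a Boolean function, hence constancy on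
  -- the interval.
  have hcont : ContinuousOn (fun τ => decide (0 ≤ P τ)) (Set.Icc 0 t) := by
    intro τ hτ
    refine ContinuousWithinAt.mono ?_ hsub
    refine (continuousWithinAt_const (b := decide (0 ≤ P τ))).congr_of_eventuallyEq ?_ rfl
    by_cases h0 : 0 ≤ P τ
    · filter_upwards [hopen τ (hsub hτ) h0] with τ' h1
      simp [h0, h1]
    · filter_upwards [(hPc τ (hsub hτ)).eventually_lt_const (not_le.1 h0)] with τ' h1
      simp [h0, h1]
  have := isPreconnected_Icc.constant hcont (Set.left_mem_Icc.2 ht.1.le)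
    (Set.right_mem_Icc.2 ht.1.le)
  exact decide_eq_decide.1 this

end WeakSolution

end NonlocalWave

end

/-! ### Invariance of the two sets -/

theorem lemma3p2 (l b : ℝ → ℝ) (ρ r p c₁ c₂ c₃ c₄ : ℝ)
    (hl : ContDiff ℝ ∞ l) (hb : ContDiff ℝ ∞ b)
    (hc₁ : 0 < c₁) (hc₂ : 0 < c₂) (hc₃ : 0 < c₃) (hc₄ : 0 < c₄)
    (hl_lower : ∀ ξ : ℝ, c₁ ^ 2 * (1 + ξ ^ 2) ^ (ρ / 2) ≤ l ξ)
    (hl_upper : ∀ ξ : ℝ, l ξ ≤ c₂ ^ 2 * (1 + ξ ^ 2) ^ (ρ / 2))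
    (hb_lower : ∀ ξ : ℝ, c₃ ^ 2 * (1 + ξ ^ 2) ^ (-r / 2) ≤ b ξ)
    (hb_upper : ∀ ξ : ℝ, b ξ ≤ c₄ ^ 2 * (1 + ξ ^ 2) ^ (-r / 2))
    (hρ : 0 ≤ ρ) (hr : 0 ≤ r) (hρr : 1 ≤ r + ρ / 2) (hne : (ρ, r) ≠ (0, 1)) (hp : 1 < p)
    (u₀ w₀ : NonlocalWave.RealL2) (T : EReal) (u w : ℝ → NonlocalWave.RealL2)
    (hsol : NonlocalWave.IsSolution l b ρ r p u₀ w₀ T u w) :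
    ((u₀, w₀) ∈ NonlocalWave.sigmaPlus l b ρ r p →
      ∀ t : ℝ, 0 < t → (t : EReal) < T → (u t, w t) ∈ NonlocalWave.sigmaPlus l b ρ r p) ∧
    ((u₀, w₀) ∈ NonlocalWave.sigmaMinus l b ρ r p →
      ∀ t : ℝ, 0 < t → (t : EReal) < T → (u t, w t) ∈ NonlocalWave.sigmaMinus l b ρ r p) := by
  -- Since 2s₀ = (r + ρ/2) + ρ/2 ≥ 1, equality would force ρ = 0 and r = 1, the excluded pair.
  have hhalf : 1 / 2 < NonlocalWave.s₀ ρ r := by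
    rw [NonlocalWave.s₀]
    rcases hρ.eq_or_lt with h0 | h0
    · have : r ≠ 1 := fun h1 => hne (by rw [← h0, h1])
      have : 1 < r := lt_of_le_of_ne (by linarith) this.symm
      linarith
    · linarith
  have hs : NonlocalWave.s₀ ρ r - ρ / 2 = r / 2 := by rw [NonlocalWave.s₀]; ring
  have adm : NonlocalWave.Admissible l b ρ r p :=
    { continuous_l := hl.continuous
      continuous_b := hb.continuous
      l_lower := ⟨c₁ ^ 2, by positivity, fun η => hl_lower _⟩
      l_upper := ⟨c₂ ^ 2, by positivity, fun η => hl_upper _⟩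
      b_lower := ⟨c₃ ^ 2, by positivity, fun η => hb_lower _⟩
      b_upper := ⟨c₄ ^ 2, by positivity, fun η => hb_upper _⟩
      rho_nonneg := hρ
      r_nonneg := hr
      one_le := hρr
      half_lt := hhalf
      one_lt_p := hp }
  have ws : NonlocalWave.WeakSolution l b ρ r p T u w :=
    { adm := adm
      cont_u := hsol.continuous_u
      cont_w := hs ▸ hsol.continuous_w
      eq_u := fun φ t ht => hsol.equation_u φ t ht.1 ht.2
      eq_w := fun φ t ht => hsol.equation_w φ t ht.1 ht.2 }
  have hspace : ∀ t : ℝ, 0 < t → (t : EReal) < T →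
      (u t, w t) ∈ NonlocalWave.energySpace ρ r := fun t h0 hT =>
    ⟨hsol.continuous_u.1 t ⟨h0.le, hT⟩, hsol.continuous_w.1 t ⟨h0.le, hT⟩⟩
  constructor
  · rintro ⟨-, hd, hP⟩ t h0 hT
    rw [← hsol.initial_u, ← hsol.initial_w] at hd
    rw [← hsol.initial_u] at hP
    refine ⟨hspace t h0 hT, ?_, (ws.nehari_nonneg_iff hd ⟨h0, hT⟩).1 hP⟩
    rwa [ws.energy_conservation ⟨h0, hT⟩]
  · rintro ⟨-, hd, hP⟩ t h0 hT
    rw [← hsol.initial_u, ← hsol.initial_w] at hd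
    rw [← hsol.initial_u] at hP
    refine ⟨hspace t h0 hT, ?_, ?_⟩
    · rwa [ws.energy_conservation ⟨h0, hT⟩]
    · exact not_le.1 fun h1 => not_le.2 hP ((ws.nehari_nonneg_iff hd ⟨h0, hT⟩).2 h1)
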